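/- Let $m,n,k\ge 0$ be integers. Let $\mathrm{OP}(m,n)^k$ be the set of ordered multiset partitions $\pi$ with $m$ letters $0$, $n$ positive integer letters (counted with multiplicity) and $m+k$ blocks, that is, sequences of $m+k$ nonempty finite sets (blocks) of nonnegative integers in which $0$ lies in exactly $m$ blocks and the numbers of positive elements of the blocks add up to $n$. Let $\mathrm{OP}^L(m,n)^k$, $\mathrm{OP}^R(m,n)^k$ be the subsets of those $\pi$ having no $0$ in the leftmost, respectively rightmost, block (the empty partition belongs to both). Put $x^\pi=\prod_{i\ge1}x_i^{\alpha_i}$, where $\alpha_i$ is the number of letters $i$ in $\pi$. All pairs below are pairs $(i,j)$ of letters of $\pi$ (counted as occurrences) such that the block of $i$ is strictly to the left of the block of $j$. * $\mathrm{inv}(\pi)$ is the number of such pairs with $j<i$ and $j$ minimal in its block. * $\mathrm{dinv}(\pi)$ is the number of such pairs for which either $j<i$ and $i,j$ are both the $h$-th smallest elements of their blocks for some $h$, or $i<j$, $i$ is the $h$-th smallest element of its block and $j$ is the $(h+1)$-th smallest element of its block for some $h$. Define $$\mathrm{OP}^{R,\mathrm{dinv}}(m,n)^k=\sum_{\pi\in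 \mathrm{OP}^R(m,n)^k}q^{\mathrm{dinv}(\pi)}x^\pi,\qquad \mathrm{OP}^{L,\mathrm{inv}}(m,n)^k=\sum_{\pi\in \mathrm{OP}^L(m,n)^k}q^{\mathrm{inv}(\pi)}x^\pi .$$ Let $\Lambda$ be the algebra of symmetric functions in $x_1,x_2,\dots$ over $\mathbb{Q}(q,t)$, and let $h_j^\perp:\Lambda\to\Lambda$ be the adjoint of multiplication by the complete homogeneous symmetric function $h_j$ with respect to the Hall scalar product. Let $\binom{a}{b}_q=\frac{[a]_q!}{[b]_q!\,[a-b]_q!}$ for $0\le b\le a$, and $\binom{a}{b}_q=0$ otherwise (also for negative $b$). Then all the series $\mathrm{OP}^{R,\mathrm{dinv}}(m,n)^k$ and $\mathrm{OP}^{L,\mathrm{inv}}(m,n)^k$ lie in $\Lambda$, and for $1\le j<n$, $1\le k\le n$ and $m\ge0$, $$\begin{aligned} h_j^\perp\, \mathrm{OP}^{R,\mathrm{dinv}}(m,n)^{k} ={}& \sum_{s=0}^{k} q^{\binom{j-s}{2}} \binom{m}{j-s}_q \binom{m+s}{s}_q q^s\, \mathrm{OP}^{R,\mathrm{dinv}}(m+s,n-j)^{k-s}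 \\ &+ \sum_{s=0}^{k} q^{\binom{j-s}{2}} \binom{m}{j-s}_q \binom{m+s-1}{s-1}_q \sum_{r=1}^{m+s} \Bigl(\mathrm{OP}^{L,\mathrm{inv}}(m+s-r,n-j)^{k-s} + \mathrm{OP}^{L,\mathrm{inv}}(m+s-r,n-j)^{k-s+1}\Bigr). \end{aligned}$$ Moreover, for all $m,k\ge 0$, $\ \mathrm{OP}^{R,\mathrm{dinv}}(m,0)^{k} = \delta_{k,0}\,\delta_{m,0}$. -/

import Mathlib

noncomputable section

namespace OrdSetPart

/-! ### Ground field and `q`-analogues -/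

/-- The field `ℚ(q,t)`. -/
abbrev Kqt : Type := FractionRing (MvPolynomial (Fin 2) ℚ)

/-- The indeterminate `q` of `ℚ(q,t)` (the other one, `X 1`, is `t`). -/
def q : Kqt := algebraMap (MvPolynomial (Fin 2) ℚ) Kqt (MvPolynomial.X 0)

/-- `[n]_q = 1 + q + ⋯ + q^(n-1)`. -/
def qNum (n : ℕ) : Kqt := ∑ i ∈ Finset.range n, q ^ i

/-- `[n]_q! = [n]_q ⋯ [1]_q`. -/
def qFact (n : ℕ) : Kqt := ∏ i ∈ Finset.range n, qNum (i + 1)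

/-- The `q`-binomial coefficient `[n choose k]_q`, with the value `0` unless `0 ≤ k ≤ n`. -/
def qBinom (n k : ℤ) : Kqt :=
  if 0 ≤ k ∧ k ≤ n then qFact n.toNat / (qFact k.toNat * qFact (n - k).toNat) else 0

/-! ### Symmetric functions -/

/-- Formal power series in `x₁, x₂, …`; the variable `X i` stands for `x_{i+1}`. -/
abbrev Series : Type := MvPowerSeries ℕ Kqt

/-- The algebra `Λ` of symmetric functions over `ℚ(q,t)`: the power series of bounded degree in
`x₁, x₂, …` that are invariant under all permutations of the variables. -/
def Sym : Subalgebra Kqt Series where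
  carrier := {f | (∀ σ : Equiv.Perm ℕ, MvPowerSeries.renameEquiv Kqt σ f = f) ∧
    ∃ N : ℕ, ∀ d : ℕ →₀ ℕ, N < d.degree → MvPowerSeries.coeff d f = 0}
  mul_mem' := by
    rintro f g ⟨hf, N, hN⟩ ⟨hg, M, hM⟩
    refine ⟨fun σ => by rw [map_mul, hf, hg], N + M, fun d hd => ?_⟩
    classical
    rw [MvPowerSeries.coeff_mul]
    refine Finset.sum_eq_zero fun p hp => ?_
    have h : p.1.degree + p.2.degree = d.degree := by
      rw [← Finset.HasAntidiagonal.mem_antidiagonal.1 hp, map_add]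
    rcases lt_or_ge N p.1.degree with h1 | h1
    · rw [hN _ h1, zero_mul]
    · rw [hM _ (by omega), mul_zero]
  add_mem' := by
    rintro f g ⟨hf, N, hN⟩ ⟨hg, M, hM⟩
    refine ⟨fun σ => by rw [map_add, hf, hg], N + M, fun d hd => ?_⟩
    rw [map_add, hN _ (by omega), hM _ (by omega), add_zero]
  algebraMap_mem' := by
    intro r
    refine ⟨fun σ => AlgEquiv.commutes _ r, 0, fun d hd => ?_⟩
    classical
    rw [MvPowerSeries.algebraMap_apply, Algebra.algebraMap_self, RingHom.id_apply,
      MvPowerSeries.coeff_C, if_neg]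
    rintro rfl
    simp at hd

/-- A power series whose coefficients are invariant under permuting exponents and which is
supported in degree `n` is a symmetric function. -/
theorem mem_Sym_of_coeff {f : Series} (n : ℕ)
    (h1 : ∀ (σ : Equiv.Perm ℕ) (d : ℕ →₀ ℕ),
      MvPowerSeries.coeff (d.embDomain σ.toEmbedding) f = MvPowerSeries.coeff d f)
    (h2 : ∀ d : ℕ →₀ ℕ, MvPowerSeries.coeff d f ≠ 0 → d.degree = n) : f ∈ Sym := by
  refine ⟨fun σ => ?_, n, fun d hd => ?_⟩
  · ext d
    obtain ⟨e, rfl⟩ : ∃ e : ℕ →₀ ℕ, d = e.embDomain σ.toEmbedding := by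
      refine ⟨d.embDomain σ.symm.toEmbedding, ?_⟩
      ext i
      have := Finsupp.embDomain_apply_self σ.toEmbedding (d.embDomain σ.symm.toEmbedding) (σ.symm i)
      have h' := Finsupp.embDomain_apply_self σ.symm.toEmbedding d i
      simp only [Equiv.coe_toEmbedding, Equiv.apply_symm_apply] at this h'
      rw [this, h']
    rw [h1]
    exact MvPowerSeries.coeff_embDomain_rename σ.toEmbedding f e
  · by_contra h
    exact absurd (h2 d h) (by omega)

/-- The multiset of nonzero exponents of a monomial. -/
def exps (d : ℕ →₀ ℕ) : Multiset ℕ := d.support.val.map d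

theorem exps_embDomain (σ : Equiv.Perm ℕ) (d : ℕ →₀ ℕ) :
    exps (d.embDomain σ.toEmbedding) = exps d := by
  unfold exps
  rw [Finsupp.support_embDomain, Finset.map_val, Multiset.map_map]
  refine Multiset.map_congr rfl fun i _ => ?_
  exact Finsupp.embDomain_apply_self σ.toEmbedding d i

theorem sum_exps (d : ℕ →₀ ℕ) : (exps d).sum = d.degree := rfl

/-- The complete homogeneous symmetric function `h_j`, the sum of all monomials of degree `j`. -/
def hSym (j : ℕ) : Sym :=
  ⟨fun d => if d.degree = j then 1 else 0, by
    refine mem_Sym_of_coeff j (fun σ d => ?_) (fun d hd => ?_)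
    · change (if _ then _ else _) = (if _ then _ else _)
      rw [← sum_exps, ← sum_exps, exps_embDomain]
    · by_contra h
      exact hd (if_neg h)⟩

/-- Integer partitions (of all sizes). -/
abbrev Part : Type := (n : ℕ) × n.Partition

/-- `h_μ = h_{μ₁} h_{μ₂} ⋯`. -/
def hPart (μ : Part) : Sym := (μ.2.parts.map hSym).prod

open Classical in
/-- The monomial symmetric function `m_μ`, the sum of all monomials with exponents `μ`. -/
def mPart (μ : Part) : Sym :=
  ⟨fun d => if exps d = μ.2.parts then 1 else 0, by
    refine mem_Sym_of_coeff μ.1 (fun σ d => ?_) (fun d hd => ?_)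
    · change (if _ then _ else _) = (if _ then _ else _)
      rw [exps_embDomain]
    · by_contra h
      refine hd (if_neg fun h' => h ?_)
      rw [← sum_exps, h', μ.2.parts_sum]⟩

open Classical in
/-- The defining property of the Hall scalar product: the bases `m_μ` and `h_μ` are dual. -/
def IsHall (B : Sym →ₗ[Kqt] Sym →ₗ[Kqt] Kqt) : Prop :=
  ∀ μ ν : Part, B (mPart μ) (hPart ν) = if μ = ν then 1 else 0

/-- The Hall scalar product on `Λ`. -/
def hall : Sym →ₗ[Kqt] Sym →ₗ[Kqt] Kqt := Classical.epsilon IsHall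

/-- `h_j^⊥ : Λ → Λ`, the adjoint of multiplication by `h_j` for the Hall scalar product:
`⟨h_j^⊥ f, g⟩ = ⟨f, h_j g⟩`. -/
def hPerp (j : ℕ) : Sym →ₗ[Kqt] Sym :=
  Classical.epsilon fun T : Sym →ₗ[Kqt] Sym =>
    LinearMap.IsAdjointPair hall hall T (fun g => hSym j * g)

/-! ### Ordered multiset partitions -/

/-- The number of occurrences of the letter `i` in a sequence of blocks. -/
def mult (i : ℕ) (π : List (Finset ℕ)) : ℕ := π.countP (fun B => i ∈ B)

/-- `OP(m,n)^k`: the ordered multiset partitions with `m` letters `0`, `n` nonzero letters (counted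
with multiplicity) and `m + k` blocks, listed from left to right; blocks are nonempty sets. -/
def OP (m n k : ℕ) : Set (List (Finset ℕ)) :=
  {π | (∀ B ∈ π, B.Nonempty) ∧ mult 0 π = m ∧
    (π.map fun B => (B.erase 0).card).sum = n ∧ π.length = m + k}

/-- `OP^L(m,n)^k`: no `0` in the leftmost block. -/
def OPL (m n k : ℕ) : Set (List (Finset ℕ)) := {π ∈ OP m n k | ∀ B ∈ π.head?, 0 ∉ B}

/-- `OP^R(m,n)^k`: no `0` in the rightmost block. -/
def OPR (m n k : ℕ) : Set (List (Finset ℕ)) := {π ∈ OP m n k | ∀ B ∈ π.getLast?, 0 ∉ B}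

/-- The sum of `f B C` over all pairs of blocks such that `B` stands to the left of `C`. -/
def pairSum (f : Finset ℕ → Finset ℕ → ℕ) : List (Finset ℕ) → ℕ
  | [] => 0
  | B :: π => (π.map (f B)).sum + pairSum f π

/-- Number of pairs `(i,j)`, `i ∈ B`, `j ∈ C`, with `j < i` and `j` minimal in `C`. -/
def invPair (B C : Finset ℕ) : ℕ :=
  ((B ×ˢ C).filter fun p => p.2 < p.1 ∧ ∀ c ∈ C, p.2 ≤ c).card

/-- `inv(π)`. -/
def inv (π : List (Finset ℕ)) : ℕ := pairSum invPair π

/-- `i ∈ B` is the `(rank B i + 1)`-th smallest element of `B`. -/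
def rank (B : Finset ℕ) (i : ℕ) : ℕ := (B.filter fun b => b < i).card

/-- Number of pairs `(i,j)`, `i ∈ B`, `j ∈ C`, forming a primary diagonal inversion (`j < i`, and
`i`, `j` are both the `h`-th smallest of their blocks for some `h`) or a secondary one (`i < j`, `i`
is the `h`-th smallest of `B` and `j` the `(h+1)`-th smallest of `C`). -/
def dinvPair (B C : Finset ℕ) : ℕ :=
  ((B ×ˢ C).filter fun p =>
    (p.2 < p.1 ∧ rank C p.2 = rank B p.1) ∨ (p.1 < p.2 ∧ rank C p.2 = rank B p.1 + 1)).card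

/-- `dinv(π)`. -/
def dinv (π : List (Finset ℕ)) : ℕ := pairSum dinvPair π

/-- The elements `π` of a set `S` of ordered multiset partitions with `x^π = x^d`, i.e. with `d i`
letters `i + 1` for every `i`. -/
def ofContent (S : Set (List (Finset ℕ))) (d : ℕ →₀ ℕ) : Set (List (Finset ℕ)) :=
  {π ∈ S | ∀ i : ℕ, mult (i + 1) π = d i}

theorem finite_ofContent {S : Set (List (Finset ℕ))} {m n k : ℕ} (hS : S ⊆ OP m n k)
    (d : ℕ →₀ ℕ) : (ofContent S d).Finite := by
  classical
  let U : Finset ℕ := insert 0 (d.support.image Nat.succ)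
  refine ((List.finite_length_eq {B : Finset ℕ // B ⊆ U} (m + k)).image
    (List.map Subtype.val)).subset ?_
  rintro π ⟨hπ, hd⟩
  have hU : ∀ B ∈ π, B ⊆ U := by
    intro B hB i hi
    rcases i with _ | i
    · exact Finset.mem_insert_self _ _
    · refine Finset.mem_insert_of_mem (Finset.mem_image_of_mem _ ?_)
      rw [Finsupp.mem_support_iff, ← hd i]
      exact (List.countP_pos_iff.2 ⟨B, hB, by simpa using hi⟩).ne'
  refine ⟨π.attachWith _ hU, ?_, ?_⟩
  · simpa using (hS hπ).2.2.2
  · simp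

theorem finite_OPR (m n k : ℕ) (d : ℕ →₀ ℕ) : (ofContent (OPR m n k) d).Finite :=
  finite_ofContent (fun _ h => h.1) d

theorem finite_OPL (m n k : ℕ) (d : ℕ →₀ ℕ) : (ofContent (OPL m n k) d).Finite :=
  finite_ofContent (fun _ h => h.1) d

/-- `∑_{π ∈ OP^R(m,n)^k} q^{dinv(π)} x^π`. -/
def dinvOPR (m n k : ℕ) : Series :=
  fun d => ∑ π ∈ (finite_OPR m n k d).toFinset, q ^ dinv π

/-- `∑_{π ∈ OP^L(m,n)^k} q^{inv(π)} x^π`. -/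
def invOPL (m n k : ℕ) : Series :=
  fun d => ∑ π ∈ (finite_OPL m n k d).toFinset, q ^ inv π

end OrdSetPart

end

/-! `hall` and `hPerp j` are only chosen by their defining properties, so existence comes first: the
`m_μ` and the `h_μ` are shown to be bases of Λ. Pairing with `h_μ` then reads off a monomial
coefficient, and `h_j^⊥` is the extraction of the coefficient of `x₁^j` (`coeff_hPerp`). The theorem
becomes a statement about block sequences that contain, besides `m` zeros, `j` copies of the next
letter.

Let `I(e, B)` (`invGF`) be the generating function of inv over all sequences of `B` nonempty blocks
with content `e`, where `0` is treated as an ordinary letter. Removing the largest letter gives a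
recursion for `I`. It also holds for dinv: for both statistics a new largest letter has the weights
`0, 1, 2, …` on the existing blocks in some order, and a new singleton block forms one pair with
each block to its right that is not another copy of it. The coefficients of the recursion are those
that expand `e_L e_j` in the `e_{L+b}`, where the elementary symmetric functions are evaluated at
`1, q, …, q^(c-1)` (`qElem_mul_qElem`). Hence `∑_B e_B I(e, B) = ∏_i e_{e(i)}` for every `c`
(`sum_qElem_mul_invGF`). This system is triangular in `B`, so it determines `I`. Thus `I` is
symmetric in all multiplicities, that of `0` included. This makes both families of series symmetric
and lets the smallest positive letter be absorbed into the zeros (`invGF_consExp_consExp`).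

The boundary conditions only cost a `q`-number. Of `I(e, B)`, with `m` zeros, the fraction `[m]/[B]`
has a `0` in the first block for inv, and `q^(B-m) [m]/[B]` has one in the last block for dinv. So a
coefficient `R` of `OP^R` satisfies `[m+k] R = [k] I`. In the absorbed sum, `[k]` is split as `[s] +
q^s [k-s]`. The part with `q^s [k-s]` is the first sum of the theorem. In the other part, `[s]
binom(m+s, s) = [m+s] binom(m+s-1, s-1)` produces the sequences with `m+s` zeros and a zero in the
first block; stripping that zero repeatedly (`sum_coeffL`) gives the `OP^L` terms. -/

noncomputable section

namespace OrdSetPart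

/-! ### Coefficients of symmetric functions -/

/-- The coefficient of `x^d`, as a linear form on symmetric functions. -/
def coeffSym (d : ℕ →₀ ℕ) : Sym →ₗ[Kqt] Kqt :=
  (MvPowerSeries.coeff d).comp Sym.val.toLinearMap

theorem coeffSym_apply (d : ℕ →₀ ℕ) (f : Sym) :
    coeffSym d f = MvPowerSeries.coeff d (f : Series) := rfl

theorem Sym_ext {f g : Sym} (h : ∀ d, coeffSym d f = coeffSym d g) : f = g :=
  Subtype.ext (MvPowerSeries.ext h)

theorem coeff_hSym (j : ℕ) (d : ℕ →₀ ℕ) : coeffSym d (hSym j) = if d.degree = j then 1 else 0 :=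
  rfl

open Classical in
theorem coeff_mPart (μ : Part) (d : ℕ →₀ ℕ) :
    coeffSym d (mPart μ) = if exps d = μ.2.parts then 1 else 0 :=
  rfl

/-- The version for series that need not be homogeneous, as required for `extract`. -/
theorem mem_Sym_of_coeff_of_bound {f : Series} (N : ℕ)
    (h1 : ∀ (σ : Equiv.Perm ℕ) (d : ℕ →₀ ℕ),
      MvPowerSeries.coeff (d.embDomain σ.toEmbedding) f = MvPowerSeries.coeff d f)
    (h2 : ∀ d : ℕ →₀ ℕ, N < d.degree → MvPowerSeries.coeff d f = 0) : f ∈ Sym := by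
  refine ⟨fun σ => ?_, N, h2⟩
  ext d
  obtain ⟨e, rfl⟩ : ∃ e : ℕ →₀ ℕ, d = e.embDomain σ.toEmbedding := by
    refine ⟨d.embDomain σ.symm.toEmbedding, ?_⟩
    ext i
    have := Finsupp.embDomain_apply_self σ.toEmbedding (d.embDomain σ.symm.toEmbedding) (σ.symm i)
    have h' := Finsupp.embDomain_apply_self σ.symm.toEmbedding d i
    simp only [Equiv.coe_toEmbedding, Equiv.apply_symm_apply] at this h'
    rw [this, h']
  rw [h1]
  exact MvPowerSeries.coeff_embDomain_rename σ.toEmbedding f e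

theorem coeffSym_embDomain (f : Sym) (σ : Equiv.Perm ℕ) (d : ℕ →₀ ℕ) :
    coeffSym (d.embDomain σ.toEmbedding) f = coeffSym d f := by
  rw [coeffSym_apply, coeffSym_apply]
  conv_lhs => rw [← f.2.1 σ]
  exact MvPowerSeries.coeff_embDomain_rename σ.toEmbedding (f : Series) d

theorem zero_notMem_exps (d : ℕ →₀ ℕ) : 0 ∉ exps d := by
  simp [exps]

theorem count_exps (d : ℕ →₀ ℕ) (v : ℕ) :
    (exps d).count v = (d.support.filter fun i => d i = v).card := by
  rw [exps, Multiset.count_map, Finset.card, Finset.filter_val]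
  simp only [eq_comm]

/-- Level sets are matched value by value: those of a nonzero value are finite of equal size, those
of the value `0` are both countably infinite. -/
theorem exists_perm_of_exps_eq {d d' : ℕ →₀ ℕ} (h : exps d = exps d') :
    ∃ σ : Equiv.Perm ℕ, d' = d.embDomain σ.toEmbedding := by
  have key : ∀ v : ℕ, Nonempty ({i // d i = v} ≃ {i // d' i = v}) := by
    intro v
    rcases eq_or_ne v 0 with rfl | hv
    · have inf : ∀ e : ℕ →₀ ℕ, Infinite {i // e i = 0} := by
        intro e
        refine Set.infinite_coe_iff.2 ?_
        have := e.hasFiniteSupport.infinite_compl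
        refine this.mono fun i hi => ?_
        exact Function.notMem_support.1 hi
      have := inf d
      have := inf d'
      have : Denumerable {i // d i = 0} := Classical.choice (nonempty_denumerable _)
      have : Denumerable {i // d' i = 0} := Classical.choice (nonempty_denumerable _)
      exact ⟨Denumerable.equiv₂ _ _⟩
    · have e1 : ∀ e : ℕ →₀ ℕ, ∀ i, i ∈ e.support.filter (fun i => e i = v) ↔ e i = v := by
        intro e i
        simp only [Finset.mem_filter, Finsupp.mem_support_iff, and_iff_right_iff_imp]
        rintro rfl
        exact hv
      have h1 := count_exps d v
      have h2 := count_exps d' v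
      rw [h, h2] at h1
      exact ⟨(Equiv.subtypeEquivRight (fun i => (e1 d i).symm)).trans
        ((Finset.equivOfCardEq h1.symm).trans (Equiv.subtypeEquivRight (e1 d')))⟩
  let φ := fun v => Classical.choice (key v)
  -- The bijections of the fibres of `d` and `d'` are glued to a permutation of all indices.
  let σ : ℕ ≃ ℕ := (Equiv.sigmaFiberEquiv d).symm.trans
    ((Equiv.sigmaCongrRight φ).trans (Equiv.sigmaFiberEquiv d'))
  have hσ : ∀ i, d' (σ i) = d i := fun i => (φ (d i) ⟨i, rfl⟩).2
  refine ⟨σ, ?_⟩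
  ext i
  obtain ⟨i, rfl⟩ := σ.surjective i
  rw [hσ]
  exact (Finsupp.embDomain_apply_self σ.toEmbedding d i).symm

theorem coeffSym_congr (f : Sym) {d d' : ℕ →₀ ℕ} (h : exps d = exps d') :
    coeffSym d f = coeffSym d' f := by
  obtain ⟨σ, rfl⟩ := exists_perm_of_exps_eq h
  exact (coeffSym_embDomain f σ d).symm

/-! ### Exponents with a new first entry, and partitions attached to exponents. -/

/-- The exponent with value `j` at `0` and `d i` at `i + 1`. -/
def consExp (j : ℕ) (d : ℕ →₀ ℕ) : ℕ →₀ ℕ :=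
  Finsupp.single 0 j + d.embDomain ⟨Nat.succ, Nat.succ_injective⟩

@[simp] theorem consExp_zero (j : ℕ) (d : ℕ →₀ ℕ) : consExp j d 0 = j := by
  have : d.embDomain ⟨Nat.succ, Nat.succ_injective⟩ 0 = 0 :=
    Finsupp.embDomain_of_notMem_range _ _ _ (by simp)
  simp [consExp, this]

@[simp] theorem consExp_succ (j : ℕ) (d : ℕ →₀ ℕ) (i : ℕ) : consExp j d (i + 1) = d i := by
  have : d.embDomain ⟨Nat.succ, Nat.succ_injective⟩ (i + 1) = d i :=
    Finsupp.embDomain_apply_self ⟨Nat.succ, Nat.succ_injective⟩ d i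
  simp [consExp, this]

theorem support_consExp {j : ℕ} (hj : j ≠ 0) (d : ℕ →₀ ℕ) :
    (consExp j d).support = Finset.cons 0 (d.support.map ⟨Nat.succ, Nat.succ_injective⟩)
      (by simp) := by
  ext i
  rcases i with _ | i <;> simp [hj]

theorem exps_consExp {j : ℕ} (hj : j ≠ 0) (d : ℕ →₀ ℕ) : exps (consExp j d) = j ::ₘ exps d := by
  unfold exps
  rw [support_consExp hj, Finset.cons_val, Multiset.map_cons, consExp_zero, Finset.map_val,
    Multiset.map_map]
  congr 1
  exact Multiset.map_congr rfl fun i _ => consExp_succ j d i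

theorem exps_consExp_zero (d : ℕ →₀ ℕ) : exps (consExp 0 d) = exps d := by
  rw [consExp, Finsupp.single_zero, zero_add]
  unfold exps
  rw [Finsupp.support_embDomain, Finset.map_val, Multiset.map_map]
  exact Multiset.map_congr rfl fun i _ => Finsupp.embDomain_apply_self _ d i

theorem degree_consExp (j : ℕ) (d : ℕ →₀ ℕ) : (consExp j d).degree = j + d.degree := by
  rcases eq_or_ne j 0 with rfl | hj
  · rw [zero_add, ← sum_exps, ← sum_exps, exps_consExp_zero]
  · rw [← sum_exps, exps_consExp hj, Multiset.sum_cons, sum_exps]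

theorem exists_exps_eq (s : Multiset ℕ) (hs : 0 ∉ s) : ∃ d : ℕ →₀ ℕ, exps d = s := by
  induction s using Multiset.induction_on with
  | empty => exact ⟨0, by simp [exps]⟩
  | cons a s ih =>
    obtain ⟨d, rfl⟩ := ih (fun h => hs (Multiset.mem_cons_of_mem h))
    exact ⟨consExp a d, exps_consExp (fun h => hs (by simp [h])) d⟩

/-- The partition formed by the nonzero exponents of a monomial. -/
def partOf (d : ℕ →₀ ℕ) : Part :=
  ⟨d.degree, ⟨exps d, fun hi => Nat.pos_of_ne_zero fun h => zero_notMem_exps d (h ▸ hi),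
    sum_exps d⟩⟩

theorem Part_ext {μ ν : Part} (h : μ.2.parts = ν.2.parts) : μ = ν := by
  obtain ⟨n, μ, hμ, rfl⟩ := μ
  obtain ⟨n, ν, hν, rfl⟩ := ν
  obtain rfl : μ = ν := h
  rfl

theorem exists_partOf_eq (μ : Part) : ∃ d, partOf d = μ := by
  obtain ⟨d, hd⟩ := exists_exps_eq μ.2.parts (fun h => lt_irrefl _ (μ.2.parts_pos h))
  exact ⟨d, Part_ext hd⟩

theorem exps_eq_iff (d : ℕ →₀ ℕ) (μ : Part) : exps d = μ.2.parts ↔ partOf d = μ :=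
  ⟨fun h => Part_ext h, fun h => by rw [← h]; rfl⟩

open Classical in
theorem coeff_mPart_partOf (μ : Part) (d : ℕ →₀ ℕ) :
    coeffSym d (mPart μ) = if partOf d = μ then 1 else 0 := by
  rw [coeff_mPart]
  simp only [exps_eq_iff]

/-! ### The monomial basis -/

theorem linearIndependent_mPart : LinearIndependent Kqt mPart := by
  classical
  rw [linearIndependent_iff']
  intro s g hg μ hμ
  obtain ⟨d, rfl⟩ := exists_partOf_eq μ
  have := congrArg (coeffSym d) hg
  rw [map_sum, map_zero] at this
  simpa [coeff_mPart_partOf, hμ] using this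

/-- Bounded degree leaves finitely many partitions. The last clause bounds the shapes that occur,
for the induction in `mem_hAlg_of_card_support`. -/
theorem eq_sum_mPart (f : Sym) : ∃ (s : Finset Part) (c : Part → Kqt),
    f = ∑ μ ∈ s, c μ • mPart μ ∧ ∀ μ ∈ s, ∃ d, partOf d = μ ∧ coeffSym d f ≠ 0 := by
  classical
  choose rep hrep using exists_partOf_eq
  obtain ⟨N, hN⟩ := f.2.2
  let t : Finset Part := (Finset.range (N + 1)).sigma fun _ => Finset.univ
  refine ⟨t.filter fun μ => coeffSym (rep μ) f ≠ 0, fun μ => coeffSym (rep μ) f, ?_, ?_⟩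
  · refine Sym_ext fun d => ?_
    rw [map_sum]
    simp only [map_smul, coeff_mPart_partOf, smul_eq_mul, mul_ite, mul_one, mul_zero]
    have h : coeffSym (rep (partOf d)) f = coeffSym d f := by
      refine coeffSym_congr f ?_
      exact (exps_eq_iff _ _).2 (hrep _)
    rw [Finset.sum_ite_eq]
    split_ifs with hd
    · exact h.symm
    · by_contra h0
      refine hd (Finset.mem_filter.2 ⟨?_, by rw [h]; exact h0⟩)
      refine Finset.mem_sigma.2 ⟨Finset.mem_range.2 ?_, Finset.mem_univ _⟩
      by_contra hlt
      exact h0 (hN d (by change ¬ d.degree < N + 1 at hlt; omega))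
  · intro μ hμ
    exact ⟨rep μ, hrep μ, (Finset.mem_filter.1 hμ).2⟩

theorem span_mPart : ⊤ ≤ Submodule.span Kqt (Set.range mPart) := by
  intro f _
  obtain ⟨s, c, hf, -⟩ := eq_sum_mPart f
  rw [hf]
  exact Submodule.sum_mem _ fun μ _ => Submodule.smul_mem _ _ (Submodule.subset_span ⟨μ, rfl⟩)

/-- The monomial symmetric functions as a basis. -/
def mBasis : Module.Basis Part Kqt Sym := Module.Basis.mk linearIndependent_mPart span_mPart

theorem mBasis_apply (μ : Part) : mBasis μ = mPart μ := Module.Basis.mk_apply _ _ _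

/-! ### The complete homogeneous symmetric functions span -/

/-- The power sum `p_i`. -/
def pSym (i : ℕ) (hi : i ≠ 0) : Sym :=
  mPart ⟨i, ⟨{i}, fun {a} ha => by rw [Multiset.mem_singleton.1 ha]; omega, by simp⟩⟩

theorem exps_single (a : ℕ) {i : ℕ} (hi : i ≠ 0) : exps (Finsupp.single a i) = {i} := by
  have : (Finsupp.single a i).support = {a} := Finsupp.support_single a hi
  simp [exps, this]

theorem exps_eq_singleton {d : ℕ →₀ ℕ} {i : ℕ} (h : exps d = {i}) :
    ∃ a, d = Finsupp.single a i := by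
  have hc : d.support.card = 1 := by
    have := congrArg Multiset.card h
    simpa [exps] using this
  obtain ⟨a, b, hb, rfl⟩ := Finsupp.card_support_eq_one'.1 hc
  rw [exps_single a hb] at h
  exact ⟨a, by rw [Multiset.singleton_inj.1 h]⟩

theorem coeff_pSym_mul {i : ℕ} (hi : i ≠ 0) (f : Sym) (d : ℕ →₀ ℕ) :
    coeffSym d (pSym i hi * f) =
      ∑ a ∈ d.support.filter (fun a => i ≤ d a), coeffSym (d - Finsupp.single a i) f := by
  classical
  have h0 : coeffSym d (pSym i hi * f) =
      ∑ p ∈ Finset.HasAntidiagonal.antidiagonal d, coeffSym p.1 (pSym i hi) * coeffSym p.2 f :=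
    MvPowerSeries.coeff_mul _ _ _
  rw [h0]
  simp only [pSym, coeff_mPart, ite_mul, one_mul, zero_mul]
  rw [← Finset.sum_filter]
  symm
  refine Finset.sum_bij (fun a _ => (Finsupp.single a i, d - Finsupp.single a i)) ?_ ?_ ?_ ?_
  · intro a ha
    rw [Finset.mem_filter] at ha
    refine Finset.mem_filter.2 ⟨Finset.HasAntidiagonal.mem_antidiagonal.2 ?_, exps_single a hi⟩
    exact add_tsub_cancel_of_le (Finsupp.single_le_iff.2 ha.2)
  · intro a _ b _ h
    exact (Finsupp.single_left_inj hi).1 (congrArg Prod.fst h)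
  · rintro ⟨u, v⟩ hp
    rw [Finset.mem_filter, Finset.HasAntidiagonal.mem_antidiagonal] at hp
    obtain ⟨rfl, hu⟩ := hp
    obtain ⟨a, rfl⟩ := exps_eq_singleton hu
    refine ⟨a, Finset.mem_filter.2 ⟨?_, ?_⟩, ?_⟩
    · simp [hi]
    · simp
    · simp
  · intro a _
    rfl

/-- Newton's identity `n h_n = ∑ p_i h_{n-i}`. -/
theorem newton_hSym (n : ℕ) :
    (n : Kqt) • hSym n = ∑ i ∈ Finset.range n, pSym (i + 1) i.succ_ne_zero * hSym (n - (i + 1)) := by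
  classical
  refine Sym_ext fun d => ?_
  rw [map_smul, map_sum]
  simp only [coeff_pSym_mul, coeff_hSym]
  have hdeg : ∀ i a, i ≤ d a → (d - Finsupp.single a i).degree + i = d.degree := by
    intro i a h
    conv_rhs => rw [← tsub_add_cancel_of_le (Finsupp.single_le_iff.2 h)]
    rw [map_add, Finsupp.degree_single]
  by_cases hd : d.degree = n
  · subst hd
    -- The coefficient counts pairs of a variable `a` and an exponent `i + 1 ≤ d a`; summing over
    -- `i` first gives `∑ d a`, the degree.
    have : ∀ i ∈ Finset.range d.degree, (∑ a ∈ d.support.filter (fun a => i + 1 ≤ d a),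
        if (d - Finsupp.single a (i + 1)).degree = d.degree - (i + 1) then (1 : Kqt) else 0) =
        ∑ a ∈ d.support, if i < d a then 1 else 0 := by
      intro i _
      rw [Finset.sum_filter]
      refine Finset.sum_congr rfl fun a _ => ?_
      by_cases h : i + 1 ≤ d a
      · have := hdeg _ _ h
        rw [if_pos h, if_pos (by omega), if_pos (by omega)]
      · rw [if_neg h, if_neg (by omega)]
    rw [Finset.sum_congr rfl this, Finset.sum_comm]
    have h2 : ∀ a ∈ d.support,
        (∑ i ∈ Finset.range d.degree, if i < d a then (1 : Kqt) else 0) = d a := by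
      intro a _
      rw [← Finset.sum_filter, Finset.sum_const, nsmul_eq_mul, mul_one]
      congr 1
      have : (Finset.range d.degree).filter (fun i => i < d a) = Finset.range (d a) := by
        ext i
        have := Finsupp.le_degree a d
        simp only [Finset.mem_filter, Finset.mem_range]
        omega
      rw [this, Finset.card_range]
    rw [Finset.sum_congr rfl h2, if_pos rfl, smul_eq_mul, mul_one, Finsupp.degree_apply]
    push_cast
    rfl
  · rw [if_neg hd, smul_zero]
    symm
    refine Finset.sum_eq_zero fun i hi => Finset.sum_eq_zero fun a ha => if_neg ?_
    have := hdeg _ _ (Finset.mem_filter.1 ha).2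
    have := Finset.mem_range.1 hi
    omega

/-- The algebra generated by the complete homogeneous symmetric functions. -/
def hAlg : Subalgebra Kqt Sym := Algebra.adjoin Kqt (Set.range fun i : ℕ => hSym (i + 1))

theorem hSym_zero : hSym 0 = 1 := by
  classical
  refine Sym_ext fun d => ?_
  have : coeffSym d 1 = if d = 0 then 1 else 0 := MvPowerSeries.coeff_one d
  rw [coeff_hSym, this]
  simp only [Finsupp.degree_eq_zero_iff]

theorem hSym_mem (n : ℕ) : hSym n ∈ hAlg := by
  rcases n with _ | n
  · rw [hSym_zero]
    exact one_mem _
  · exact Algebra.subset_adjoin ⟨n, rfl⟩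

/-- As `h_0 = 1`, Newton's identity expresses `p_n` by `h_n` and products of smaller `p_i` with
`h`'s. -/
theorem pSym_mem (n : ℕ) (hn : n ≠ 0) : pSym n hn ∈ hAlg := by
  induction n using Nat.strong_induction_on with
  | _ n ih =>
    obtain ⟨n, rfl⟩ := Nat.exists_eq_succ_of_ne_zero hn
    have h := newton_hSym (n + 1)
    rw [Finset.sum_range_succ, Nat.sub_self, hSym_zero, mul_one] at h
    have h' := eq_sub_of_add_eq' h.symm
    rw [h']
    refine sub_mem (Subalgebra.smul_mem _ (hSym_mem _) _) (sum_mem fun i hi => ?_)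
    exact mul_mem (ih _ (by have := Finset.mem_range.1 hi; omega) _) (hSym_mem _)

theorem card_exps (d : ℕ →₀ ℕ) : Multiset.card (exps d) = d.support.card := by
  simp [exps]

/-- Induction on the number of variables in a monomial. If `a` is a part of `λ` and `λ'` is `λ`
without it, then `p_a m_{λ'}` is a nonzero multiple of `m_λ` plus monomials in fewer variables,
produced when `a` is added to an exponent already present. -/
theorem mem_hAlg_of_card_support (k : ℕ) (f : Sym)
    (hf : ∀ d, coeffSym d f ≠ 0 → d.support.card ≤ k) : f ∈ hAlg := by
  classical
  induction k generalizing f with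
  | zero =>
    have : f = algebraMap Kqt Sym (coeffSym 0 f) := by
      refine Sym_ext fun d => ?_
      have h1 : coeffSym d (algebraMap Kqt Sym (coeffSym 0 f)) = if d = 0 then coeffSym 0 f else 0 :=
        MvPowerSeries.coeff_C d _
      rw [h1]
      split_ifs with h
      · rw [h]
      · by_contra h0
        have := hf d h0
        simp at this
        exact h this
    rw [this]
    exact Subalgebra.algebraMap_mem _ _
  | succ k ih =>
    obtain ⟨s, c, hfs, hs⟩ := eq_sum_mPart f
    rw [hfs]
    refine sum_mem fun μ hμ => Subalgebra.smul_mem _ ?_ _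
    obtain ⟨d, rfl, hd⟩ := hs μ hμ
    have hdk := hf d hd
    rcases Nat.lt_or_ge d.support.card (k + 1) with hlt | hge
    · refine ih _ fun e he => ?_
      rw [coeff_mPart_partOf, ne_eq, ite_eq_right_iff, Classical.not_imp] at he
      have : exps e = exps d := (exps_eq_iff _ _).2 he.1
      rw [← card_exps, this, card_exps]
      omega
    obtain ⟨a, ha⟩ : d.support.Nonempty := Finset.card_pos.1 (by omega)
    have ha0 : d a ≠ 0 := Finsupp.mem_support_iff.1 ha
    let d' := d - Finsupp.single a (d a)
    have hexp : exps d = d a ::ₘ exps d' := by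
      have hsup : d'.support = d.support.erase a := by
        ext i
        by_cases h : i = a
        · subst h; simp [d']
        · simp [d', h]
      unfold exps
      rw [hsup, ← Multiset.cons_erase (show a ∈ d.support.val from ha), Multiset.map_cons,
        Finset.erase_val]
      congr 1
      refine Multiset.map_congr rfl fun i hi => ?_
      have : i ≠ a := by
        rw [← Finset.erase_val] at hi
        exact Finset.ne_of_mem_erase hi
      simp [d', Ne.symm this]
    let g := pSym (d a) ha0 * mPart (partOf d')
    have hg : g ∈ hAlg := by
      refine mul_mem (pSym_mem _ _) (ih _ fun e he => ?_)
      rw [coeff_mPart_partOf, ne_eq, ite_eq_right_iff, Classical.not_imp] at he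
      have h1 : exps e = exps d' := (exps_eq_iff _ _).2 he.1
      have h2 := congrArg Multiset.card hexp
      rw [Multiset.card_cons, card_exps] at h2
      rw [← card_exps, h1]
      omega
    -- The coefficient is a positive integer, since the variable `a` itself contributes;
    -- characteristic zero keeps it nonzero.
    have hc : coeffSym d g ≠ 0 := by
      change coeffSym d (pSym (d a) ha0 * mPart (partOf d')) ≠ 0
      rw [coeff_pSym_mul]
      simp only [coeff_mPart_partOf]
      rw [Finset.sum_boole, Nat.cast_ne_zero]
      refine (Finset.card_pos.2 ⟨a, ?_⟩).ne'
      simp [ha0, d']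
    have hrest : g - coeffSym d g • mPart (partOf d) ∈ hAlg := by
      refine ih _ fun e he => ?_
      by_contra hcard
      refine he ?_
      rw [map_sub, map_smul, coeff_mPart_partOf]
      by_cases hpe : partOf e = partOf d
      · rw [if_pos hpe, smul_eq_mul, mul_one,
          coeffSym_congr g ((exps_eq_iff e (partOf d)).2 hpe : exps e = exps d), sub_self]
      · rw [if_neg hpe, smul_zero, sub_zero]
        change coeffSym e (pSym (d a) ha0 * mPart (partOf d')) = 0
        rw [coeff_pSym_mul]
        refine Finset.sum_eq_zero fun b hb => ?_
        rw [coeff_mPart_partOf, if_neg]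
        -- Dividing `e` by the power of `b` leaves as many variables as `d'` has, one fewer than
        -- `d`. As `e` has more than `k` variables, `b` must disappear, so `e b = d a` and `e` has
        -- the exponents of `d`.
        intro hb'
        have h1 : exps (e - Finsupp.single b (d a)) = exps d' := (exps_eq_iff _ _).2 hb'
        have hcd := congrArg Multiset.card h1
        rw [card_exps] at hcd
        have h2 := congrArg Multiset.card hexp
        rw [Multiset.card_cons, card_exps] at h2
        rw [Finset.mem_filter] at hb
        have hbs : (e - Finsupp.single b (d a)).support = e.support.erase b := by
          by_cases heq : e b = d a
          · ext i
            by_cases h : i = b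
            · subst h; simp [heq]
            · simp [h]
          · exfalso
            have : (e - Finsupp.single b (d a)).support = e.support := by
              ext i
              by_cases h : i = b
              · subst h
                simp only [Finsupp.mem_support_iff, Finsupp.coe_tsub, Pi.sub_apply,
                  Finsupp.single_eq_same]
                omega
              · simp [Ne.symm h]
            rw [this] at hcd
            omega
        have heq : e b = d a := by
          by_contra hne
          have : b ∈ (e - Finsupp.single b (d a)).support := by
            simp only [Finsupp.mem_support_iff, Finsupp.coe_tsub, Pi.sub_apply,
              Finsupp.single_eq_same]
            omega
          rw [hbs] at this
          simp at this
        refine hpe (Part_ext ?_)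
        change exps e = exps d
        rw [hexp, ← h1, ← heq]
        unfold exps
        rw [heq, hbs, ← Multiset.cons_erase (show b ∈ e.support.val from hb.1), Multiset.map_cons,
          Finset.erase_val, heq]
        congr 1
        refine Multiset.map_congr rfl fun i hi => ?_
        have : i ≠ b := by
          rw [← Finset.erase_val] at hi
          exact Finset.ne_of_mem_erase hi
        simp [Ne.symm this]
    have := sub_mem hg hrest
    rw [sub_sub_cancel] at this
    have h3 := Subalgebra.smul_mem hAlg this (coeffSym d g)⁻¹
    rwa [smul_smul, inv_mul_cancel₀ hc, one_smul] at h3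

theorem hAlg_eq_top (f : Sym) : f ∈ hAlg := by
  obtain ⟨N, hN⟩ := f.2.2
  refine mem_hAlg_of_card_support N f fun d hd => ?_
  have h1 : d.degree ≤ N := by
    by_contra h
    exact hd (hN d (by omega))
  refine le_trans ?_ h1
  rw [Finsupp.degree_apply, Finset.card_eq_sum_ones]
  exact Finset.sum_le_sum fun i hi => Nat.one_le_iff_ne_zero.2 (Finsupp.mem_support_iff.1 hi)

theorem span_hPart : Submodule.span Kqt (Set.range hPart) = ⊤ := by
  refine eq_top_iff.2 fun f _ => ?_
  have hf : f ∈ Subalgebra.toSubmodule hAlg := hAlg_eq_top f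
  rw [hAlg, Algebra.adjoin_eq_span] at hf
  refine Submodule.span_mono ?_ hf
  intro x hx
  induction hx using Submonoid.closure_induction with
  | mem x hx =>
    obtain ⟨i, rfl⟩ := hx
    refine ⟨⟨i + 1, ⟨{i + 1}, fun {a} ha => by rw [Multiset.mem_singleton.1 ha]; omega,
      by simp⟩⟩, by simp [hPart]⟩
  | one => exact ⟨⟨0, ⟨0, by simp, by simp⟩⟩, by simp [hPart]⟩
  | mul x y _ _ hx hy =>
    obtain ⟨μ, rfl⟩ := hx
    obtain ⟨ν, rfl⟩ := hy
    refine ⟨⟨μ.1 + ν.1, ⟨μ.2.parts + ν.2.parts, fun {a} ha => ?_, ?_⟩⟩, ?_⟩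
    · rcases Multiset.mem_add.1 ha with h | h
      exacts [μ.2.parts_pos h, ν.2.parts_pos h]
    · rw [Multiset.sum_add, μ.2.parts_sum, ν.2.parts_sum]
    · simp [hPart]

/-! ### The Hall scalar product and `h_j^⊥` -/

/-- The homogeneous component of degree `n`. -/
def homComp (n : ℕ) : Sym →ₗ[Kqt] Sym where
  toFun f := ⟨fun d => if d.degree = n then coeffSym d f else 0, by
    refine mem_Sym_of_coeff n (fun σ d => ?_) (fun d hd => ?_)
    · change (if _ then _ else _) = (if _ then _ else _)
      rw [← sum_exps, ← sum_exps, exps_embDomain, coeffSym_embDomain]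
    · by_contra h
      exact hd (if_neg h)⟩
  map_add' f g := by
    refine Sym_ext fun d => ?_
    rw [map_add]
    change (if _ then _ else _) = (if _ then _ else _) + (if _ then _ else _)
    split_ifs
    · rw [map_add]
    · rw [add_zero]
  map_smul' c f := by
    refine Sym_ext fun d => ?_
    rw [map_smul]
    change (if _ then _ else _) = c • (if _ then _ else _)
    split_ifs
    · rw [map_smul]
    · rw [smul_zero]

theorem coeff_homComp (n : ℕ) (f : Sym) (d : ℕ →₀ ℕ) :
    coeffSym d (homComp n f) = if d.degree = n then coeffSym d f else 0 := rfl

theorem homComp_of_homogeneous {f : Sym} {N : ℕ} (hf : ∀ d, coeffSym d f ≠ 0 → d.degree = N)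
    (n : ℕ) : homComp n f = if N = n then f else 0 := by
  refine Sym_ext fun d => ?_
  rw [coeff_homComp]
  by_cases h : coeffSym d f = 0
  · split_ifs <;> simp [h]
  · rw [hf d h]
    split_ifs <;> simp

theorem homComp_mPart (n : ℕ) (μ : Part) :
    homComp n (mPart μ) = if μ.1 = n then mPart μ else 0 := by
  classical
  refine homComp_of_homogeneous (fun d hd => ?_) n
  rw [coeff_mPart_partOf, ne_eq, ite_eq_right_iff, Classical.not_imp] at hd
  rw [← hd.1]
  rfl

theorem degree_of_coeff_mul {f g : Sym} {N M : ℕ} (hf : ∀ d, coeffSym d f ≠ 0 → d.degree = N)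
    (hg : ∀ d, coeffSym d g ≠ 0 → d.degree = M) (d : ℕ →₀ ℕ) (h : coeffSym d (f * g) ≠ 0) :
    d.degree = N + M := by
  classical
  have h0 : coeffSym d (f * g) =
      ∑ p ∈ Finset.HasAntidiagonal.antidiagonal d, coeffSym p.1 f * coeffSym p.2 g :=
    MvPowerSeries.coeff_mul _ _ _
  rw [h0] at h
  obtain ⟨p, hp, hne⟩ := Finset.exists_ne_zero_of_sum_ne_zero h
  rw [← Finset.HasAntidiagonal.mem_antidiagonal.1 hp, map_add, hf _ (left_ne_zero_of_mul hne),
    hg _ (right_ne_zero_of_mul hne)]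

theorem degree_of_coeff_hPart (μ : Part) (d : ℕ →₀ ℕ) (h : coeffSym d (hPart μ) ≠ 0) :
    d.degree = μ.1 := by
  obtain ⟨n, μ, hμ, rfl⟩ := μ
  change coeffSym d (μ.map hSym).prod ≠ 0 at h
  change d.degree = μ.sum
  clear hμ
  induction μ using Multiset.induction_on generalizing d with
  | empty =>
    rw [Multiset.map_zero, Multiset.prod_zero, ← hSym_zero, coeff_hSym, ne_eq, ite_eq_right_iff,
      Classical.not_imp] at h
    exact h.1
  | cons a s ih =>
    rw [Multiset.map_cons, Multiset.prod_cons] at h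
    rw [Multiset.sum_cons]
    refine degree_of_coeff_mul (fun e he => ?_) ih d h
    rw [coeff_hSym, ne_eq, ite_eq_right_iff, Classical.not_imp] at he
    exact he.1

theorem homComp_hPart (n : ℕ) (μ : Part) :
    homComp n (hPart μ) = if μ.1 = n then hPart μ else 0 :=
  homComp_of_homogeneous (degree_of_coeff_hPart μ) n

instance finiteDimensional_range_homComp (n : ℕ) :
    FiniteDimensional Kqt (LinearMap.range (homComp n)) := by
  have h1 : LinearMap.range (homComp n) = Submodule.span Kqt (homComp n '' Set.range mPart) := by
    rw [← Submodule.map_span, eq_top_iff.2 span_mPart, LinearMap.range_eq_map]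
  rw [h1]
  refine FiniteDimensional.span_of_finite Kqt ?_
  refine ((Set.finite_range fun μ : n.Partition => mPart ⟨n, μ⟩).union
    (Set.finite_singleton 0)).subset ?_
  rintro _ ⟨_, ⟨⟨N, μ⟩, rfl⟩, rfl⟩
  rw [homComp_mPart]
  split_ifs with h
  · obtain rfl : N = n := h
    exact Or.inl ⟨μ, rfl⟩
  · exact Or.inr rfl

/-- The linear map with `m_μ ↦ h_μ`. -/
def mToH : Sym →ₗ[Kqt] Sym := mBasis.constr Kqt hPart

theorem mToH_mPart (μ : Part) : mToH (mPart μ) = hPart μ := by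
  rw [mToH, ← mBasis_apply, Module.Basis.constr_basis]

theorem mToH_surjective : Function.Surjective mToH := by
  rw [← LinearMap.range_eq_top, eq_top_iff, ← span_hPart, Submodule.span_le]
  rintro _ ⟨μ, rfl⟩
  exact ⟨_, mToH_mPart μ⟩

theorem mToH_homComp (n : ℕ) (f : Sym) : mToH (homComp n f) = homComp n (mToH f) := by
  have : mToH ∘ₗ homComp n = homComp n ∘ₗ mToH := by
    refine mBasis.ext fun μ => ?_
    rw [mBasis_apply, LinearMap.comp_apply, LinearMap.comp_apply, mToH_mPart, homComp_hPart,
      homComp_mPart]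
    split_ifs
    · rw [mToH_mPart]
    · rw [map_zero]
  exact LinearMap.congr_fun this f

/-- The map preserves degrees, and every homogeneous component is finite-dimensional, so
surjectivity in each degree forces injectivity there. This gives independence of the `h_μ` without a
triangularity argument. -/
theorem mToH_injective : Function.Injective mToH := by
  rw [injective_iff_map_eq_zero]
  intro f hf
  have hmaps : ∀ n, ∀ g ∈ LinearMap.range (homComp n), mToH g ∈ LinearMap.range (homComp n) := by
    rintro n _ ⟨g, rfl⟩
    exact ⟨mToH g, (mToH_homComp n g).symm⟩
  have hinj : ∀ n, Function.Injective (mToH.restrict (hmaps n)) := by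
    intro n
    refine (LinearMap.injective_iff_surjective (K := Kqt)
      (V := LinearMap.range (homComp n))).2 ?_
    rintro ⟨_, ⟨g, rfl⟩⟩
    obtain ⟨g, rfl⟩ := mToH_surjective g
    exact ⟨⟨homComp n g, ⟨g, rfl⟩⟩, Subtype.ext (mToH_homComp n g)⟩
  have hcomp : ∀ n, homComp n f = 0 := by
    intro n
    have h1 : mToH.restrict (hmaps n) ⟨homComp n f, ⟨f, rfl⟩⟩ = 0 := by
      refine Subtype.ext ?_
      change mToH (homComp n f) = 0
      rw [mToH_homComp, hf, map_zero]
    exact congrArg Subtype.val ((injective_iff_map_eq_zero _).1 (hinj n) _ h1)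
  refine Sym_ext fun d => ?_
  have := congrArg (coeffSym d) (hcomp d.degree)
  rwa [coeff_homComp, if_pos rfl] at this

/-- The complete homogeneous symmetric functions as a basis. -/
def hBasis : Module.Basis Part Kqt Sym :=
  mBasis.map (LinearEquiv.ofBijective mToH ⟨mToH_injective, mToH_surjective⟩)

theorem hBasis_apply (μ : Part) : hBasis μ = hPart μ := by
  rw [hBasis, Module.Basis.map_apply, mBasis_apply]
  exact mToH_mPart μ

/-- A choice has its property once some form has it: the form sending `m_μ` to the `h_μ`-coordinate
functional is one. -/
theorem isHall_hall : IsHall hall := by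
  classical
  refine Classical.epsilon_spec (p := IsHall) ⟨mBasis.constr Kqt fun μ => hBasis.coord μ, ?_⟩
  intro μ ν
  rw [← mBasis_apply, Module.Basis.constr_basis, ← hBasis_apply, Module.Basis.coord_apply,
    Module.Basis.repr_self, Finsupp.single_apply]
  simp only [eq_comm]

theorem hall_hPart (f : Sym) (d : ℕ →₀ ℕ) : hall f (hPart (partOf d)) = coeffSym d f := by
  classical
  have : hall.flip (hPart (partOf d)) = coeffSym d := by
    refine mBasis.ext fun μ => ?_
    rw [mBasis_apply, LinearMap.flip_apply, isHall_hall, coeff_mPart_partOf]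
    simp only [eq_comm]
  exact LinearMap.congr_fun this f

theorem consExp_embDomain_exps {j : ℕ} (hj : j ≠ 0) (σ : Equiv.Perm ℕ) (d : ℕ →₀ ℕ) :
    exps (consExp j (d.embDomain σ.toEmbedding)) = exps (consExp j d) := by
  rw [exps_consExp hj, exps_consExp hj, exps_embDomain]

/-- Extraction of the coefficient of `x₁^j`. -/
def extract (j : ℕ) (hj : j ≠ 0) : Sym →ₗ[Kqt] Sym where
  toFun f := ⟨fun d => coeffSym (consExp j d) f, by
    obtain ⟨N, hN⟩ := f.2.2
    refine mem_Sym_of_coeff_of_bound N (fun σ d => ?_) (fun d hd => ?_)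
    · exact coeffSym_congr f (consExp_embDomain_exps hj σ d)
    · refine hN _ ?_
      rw [degree_consExp]
      omega⟩
  map_add' f g := Sym_ext fun d => by
    rw [map_add]
    exact (coeffSym (consExp j d)).map_add f g
  map_smul' c f := Sym_ext fun d => by
    rw [map_smul]
    exact (coeffSym (consExp j d)).map_smul c f

theorem hSym_mul_hPart {j : ℕ} (hj : j ≠ 0) (d : ℕ →₀ ℕ) :
    hSym j * hPart (partOf d) = hPart (partOf (consExp j d)) := by
  change hSym j * ((exps d).map hSym).prod = ((exps (consExp j d)).map hSym).prod
  rw [exps_consExp hj, Multiset.map_cons, Multiset.prod_cons]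

/-- The witness is `extract`: multiplying `h_μ` by `h_j` adds the part `j` to `μ`, and pairing with
the result reads off the coefficient at the enlarged exponent. -/
theorem isAdjointPair_hPerp {j : ℕ} (hj : j ≠ 0) :
    LinearMap.IsAdjointPair hall hall (hPerp j) (fun g => hSym j * g) := by
  refine Classical.epsilon_spec (p := fun T : Sym →ₗ[Kqt] Sym =>
    LinearMap.IsAdjointPair hall hall T (fun g => hSym j * g)) ⟨extract j hj, ?_⟩
  intro f g
  have : hall (extract j hj f) = (hall f).comp (LinearMap.mulLeft Kqt (hSym j)) := by
    refine hBasis.ext fun μ => ?_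
    obtain ⟨d, rfl⟩ := exists_partOf_eq μ
    rw [hBasis_apply, hall_hPart, LinearMap.comp_apply, LinearMap.mulLeft_apply,
      hSym_mul_hPart hj, hall_hPart]
    rfl
  exact LinearMap.congr_fun this g

/-- Adjointness fixes all pairings with the `h_μ`, hence all coefficients, whichever adjoint was
chosen. -/
theorem coeff_hPerp {j : ℕ} (hj : j ≠ 0) (f : Sym) (d : ℕ →₀ ℕ) :
    coeffSym d (hPerp j f) = coeffSym (consExp j d) f := by
  rw [← hall_hPart, isAdjointPair_hPerp hj]
  change hall f (hSym j * hPart (partOf d)) = _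
  rw [hSym_mul_hPart hj, hall_hPart]

/-! ### `q`-binomial coefficients -/

theorem qNum_ne_zero {n : ℕ} (hn : n ≠ 0) : qNum n ≠ 0 := by
  have h : qNum n = algebraMap (MvPolynomial (Fin 2) ℚ) Kqt
      (∑ i ∈ Finset.range n, MvPolynomial.X 0 ^ i) := by
    simp [qNum, q]
  rw [h, ne_eq, FaithfulSMul.algebraMap_eq_zero_iff]
  intro h0
  -- At `q = 1` the polynomial takes the value `n`.
  have := congrArg (MvPolynomial.eval fun _ => (1 : ℚ)) h0
  simp at this
  exact hn this

theorem q_ne_zero : q ≠ 0 := by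
  rw [q, ne_eq, FaithfulSMul.algebraMap_eq_zero_iff]
  exact MvPolynomial.X_ne_zero 0

theorem qFact_ne_zero (n : ℕ) : qFact n ≠ 0 :=
  Finset.prod_ne_zero_iff.2 fun i _ => qNum_ne_zero i.succ_ne_zero

theorem qFact_succ (n : ℕ) : qFact (n + 1) = qFact n * qNum (n + 1) := Finset.prod_range_succ _ _

@[simp] theorem qFact_zero : qFact 0 = 1 := rfl

@[simp] theorem qNum_zero : qNum 0 = 0 := rfl

theorem qNum_add (a b : ℕ) : qNum (a + b) = qNum a + q ^ a * qNum b := by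
  rw [qNum, Finset.sum_range_add, qNum, qNum, Finset.mul_sum]
  simp only [pow_add]

/-- The `q`-binomial coefficient with natural number arguments. -/
def gaussBinom (n k : ℕ) : Kqt := qBinom n k

theorem gaussBinom_add (a b : ℕ) : gaussBinom (a + b) b = qFact (a + b) / (qFact b * qFact a) := by
  rw [gaussBinom, qBinom, if_pos (by omega)]
  have h1 : (((a + b : ℕ) : ℤ) - (b : ℤ)).toNat = a := by omega
  rw [h1]
  rfl

theorem gaussBinom_of_lt {n k : ℕ} (h : n < k) : gaussBinom n k = 0 := by
  rw [gaussBinom, qBinom, if_neg (by omega)]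

@[simp] theorem gaussBinom_zero (n : ℕ) : gaussBinom n 0 = 1 := by
  have := gaussBinom_add n 0
  rw [add_zero] at this
  rw [this, qFact_zero, one_mul, div_self (qFact_ne_zero n)]

@[simp] theorem gaussBinom_self (n : ℕ) : gaussBinom n n = 1 := by
  have := gaussBinom_add 0 n
  rw [zero_add] at this
  rw [this, qFact_zero, mul_one, div_self (qFact_ne_zero n)]

theorem gaussBinom_pascal' (a b : ℕ) :
    gaussBinom (a + b + 1) (b + 1) = q ^ a * gaussBinom (a + b) b + gaussBinom (a + b) (b + 1) := by
  rcases a with _ | a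
  · rw [zero_add, gaussBinom_self, gaussBinom_self, gaussBinom_of_lt (Nat.lt_succ_self b)]
    simp
  · have h1 := gaussBinom_add (a + 1) (b + 1)
    have h2 := gaussBinom_add (a + 1) b
    have h3 := gaussBinom_add a (b + 1)
    rw [show a + 1 + (b + 1) = a + 1 + b + 1 by ring] at h1
    rw [show a + (b + 1) = a + 1 + b by ring] at h3
    rw [h1, h2, h3, qFact_succ (a + 1 + b), qFact_succ a, qFact_succ b,
      show a + 1 + b + 1 = (a + 1) + (b + 1) by ring, qNum_add]
    have := qFact_ne_zero a
    have := qFact_ne_zero b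
    have := qNum_ne_zero a.succ_ne_zero
    have := qNum_ne_zero b.succ_ne_zero
    field_simp
    ring

theorem gaussBinom_trinomial (a b c : ℕ) :
    gaussBinom (a + b + c) (b + c) * gaussBinom (b + c) c =
      gaussBinom (a + b + c) c * gaussBinom (a + b) b := by
  rw [gaussBinom_add b c, gaussBinom_add a b, gaussBinom_add (a + b) c, add_assoc a b c,
    gaussBinom_add a (b + c)]
  have := qFact_ne_zero a
  have := qFact_ne_zero b
  have := qFact_ne_zero c
  have := qFact_ne_zero (a + b)
  have := qFact_ne_zero (b + c)
  field_simp

/-- `[B] [B-1 choose b] = [B choose b] [B-b]`, with `B = a + b`. -/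
theorem qNum_mul_gaussBinom_pred (a b : ℕ) :
    qNum (a + 1 + b) * gaussBinom (a + b) b = gaussBinom (a + 1 + b) b * qNum (a + 1) := by
  rw [gaussBinom_add, gaussBinom_add, show a + 1 + b = a + b + 1 by ring, qFact_succ, qFact_succ]
  have := qFact_ne_zero a
  have := qFact_ne_zero b
  have := qNum_ne_zero a.succ_ne_zero
  field_simp

/-- `e_j(1, q, …, q^(c-1))`. -/
def qElem (c j : ℕ) : Kqt := q ^ j.choose 2 * gaussBinom c j

@[simp] theorem qElem_zero (c : ℕ) : qElem c 0 = 1 := by simp [qElem]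

theorem qElem_of_lt {c j : ℕ} (h : c < j) : qElem c j = 0 := by
  rw [qElem, gaussBinom_of_lt h, mul_zero]

open Polynomial in
-- The `q`-binomial theorem, by the Pascal recursion on the last factor.
theorem coeff_prod_range_qElem (c j : ℕ) :
    (∏ i ∈ Finset.range c, (1 + C (q ^ i) * X : Kqt[X])).coeff j = qElem c j := by
  induction c generalizing j with
  | zero =>
    rcases j with _ | j
    · simp
    · rw [qElem_of_lt (Nat.succ_pos j)]
      simp [Polynomial.coeff_one]
  | succ c ih =>
    rw [Finset.prod_range_succ, mul_add, mul_one, coeff_add, ih]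
    rcases j with _ | j
    · simp
    · rw [mul_comm, mul_assoc, coeff_C_mul, mul_comm X, coeff_mul_X, ih, qElem, qElem, qElem]
      rcases Nat.lt_or_ge c j with h | h
      · rw [gaussBinom_of_lt h, gaussBinom_of_lt (by omega : c < j + 1),
          gaussBinom_of_lt (by omega : c + 1 < j + 1)]
        simp
      · obtain ⟨a, rfl⟩ := Nat.exists_eq_add_of_le' h
        rw [gaussBinom_pascal', Nat.choose_succ_succ' j 1, Nat.choose_one_right]
        ring

open Polynomial in
-- The variables split into `1, …, q^(m-1)` and `q^m` times `1, …, q^(c-1)` (`q`-Vandermonde).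
theorem qElem_add (m c j : ℕ) : qElem (m + c) j =
    ∑ s ∈ Finset.range (j + 1), qElem m (j - s) * (q ^ (m * s) * qElem c s) := by
  have h2 : (∏ i ∈ Finset.range c, (1 + C (q ^ (m + i)) * X : Kqt[X])) =
      (∏ i ∈ Finset.range c, (1 + C (q ^ i) * X : Kqt[X])).comp (C (q ^ m) * X) := by
    rw [prod_comp]
    refine Finset.prod_congr rfl fun i _ => ?_
    simp [pow_add]
    ring
  rw [← coeff_prod_range_qElem, Finset.prod_range_add, h2, mul_comm, coeff_mul,
    Finset.Nat.sum_antidiagonal_eq_sum_range_succ_mk]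
  refine Finset.sum_congr rfl fun s _ => ?_
  rw [comp_C_mul_X_coeff, coeff_prod_range_qElem, coeff_prod_range_qElem, pow_mul]
  ring

theorem add_choose_two (m s : ℕ) : (m + s).choose 2 = m.choose 2 + s.choose 2 + m * s := by
  induction s with
  | zero => simp
  | succ s ih =>
    rw [← add_assoc, Nat.choose_succ_succ' (m + s) 1, Nat.choose_succ_succ' s 1, ih,
      Nat.choose_one_right, Nat.choose_one_right]
    ring

/-- Linearization of the product of two principal specializations. -/
theorem qElem_mul_qElem (c m j : ℕ) : qElem c m * qElem c j =
    ∑ s ∈ Finset.range (j + 1),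
      qElem m (j - s) * gaussBinom (m + s) s * qElem c (m + s) := by
  rcases Nat.lt_or_ge c m with h | h
  · rw [qElem_of_lt h, zero_mul]
    symm
    refine Finset.sum_eq_zero fun s _ => ?_
    rw [qElem_of_lt (by omega : c < m + s), mul_zero]
  obtain ⟨c, rfl⟩ := Nat.exists_eq_add_of_le h
  -- From here `c` is the number of variables beyond the first `m`. After `e_j` is split at `m`, the
  -- sums agree term by term through the trinomial identity and `binom(m+s, 2) = binom(m, 2) +
  -- binom(s, 2) + ms`.
  rw [qElem_add m c j, Finset.mul_sum]
  refine Finset.sum_congr rfl fun s _ => ?_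
  rcases Nat.lt_or_ge c s with h | h
  · rw [qElem_of_lt h, qElem_of_lt (by omega : m + c < m + s)]
    simp
  obtain ⟨a, rfl⟩ := Nat.exists_eq_add_of_le' h
  have h1 := gaussBinom_trinomial a m s
  have h2 := gaussBinom_trinomial a s m
  have h3 : gaussBinom (m + s) m = gaussBinom (m + s) s := by
    rw [gaussBinom_add, add_comm m s, gaussBinom_add, mul_comm, add_comm]
  rw [add_comm s m, h3, show a + s + m = m + (a + s) by ring] at h2
  rw [qElem, qElem, qElem, qElem, add_choose_two, pow_add, pow_add]
  linear_combination (-(q ^ (j - s).choose 2 * gaussBinom m (j - s) * q ^ m.choose 2 * q ^ s.choose 2 * q ^ (m * s))) * h2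

/-! ### Inserting copies of a singleton block -/

/-- All lists obtained from `ρ` by inserting `b` copies of the block `S`. -/
def insSing (S : Finset ℕ) : List (Finset ℕ) → ℕ → Finset (List (Finset ℕ))
  | [], b => {List.replicate b S}
  | C :: ρ, 0 => (insSing S ρ 0).image (List.cons C)
  | C :: ρ, b + 1 => (insSing S ρ (b + 1)).image (List.cons C) ∪
      (insSing S (C :: ρ) b).image (List.cons S)

/-- As `S` does not occur in `ρ`, deleting and counting the copies of `S` recovers `ρ` and `b`. -/
theorem mem_insSing {S : Finset ℕ} {ρ : List (Finset ℕ)} (hS : S ∉ ρ) (b : ℕ)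
    (π : List (Finset ℕ)) :
    π ∈ insSing S ρ b ↔ π.filter (fun D => !decide (D = S)) = ρ ∧ π.count S = b := by
  induction ρ, b using insSing.induct generalizing π with
  | case1 b =>
    rw [insSing, Finset.mem_singleton, List.eq_replicate_iff]
    constructor
    · rintro ⟨h1, h2⟩
      refine ⟨List.filter_eq_nil_iff.2 fun D hD => by simp [h2 D hD], ?_⟩
      rw [← h1, List.count_eq_length]
      exact fun D hD => (h2 D hD).symm
    · rintro ⟨h1, h2⟩
      have h3 : ∀ D ∈ π, D = S := fun D hD => by
        simpa using List.filter_eq_nil_iff.1 h1 D hD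
      refine ⟨?_, h3⟩
      rw [← h2, eq_comm, List.count_eq_length]
      exact fun D hD => (h3 D hD).symm
  | case2 C ρ ih =>
    have hC : C ≠ S := fun h => hS (by simp [h])
    have ih := fun π => ih (fun h => hS (List.mem_cons_of_mem _ h)) π
    rw [insSing, Finset.mem_image]
    constructor
    · rintro ⟨τ, hτ, rfl⟩
      rw [ih] at hτ
      simp [hC, hτ.1, hτ.2]
    · rintro ⟨h1, h2⟩
      rcases π with _ | ⟨D, π⟩
      · simp at h1
      · by_cases hD : D = S
        · simp [hD] at h2
        · rw [List.filter_cons_of_pos (by simp [hD]), List.cons.injEq] at h1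
          rw [List.count_cons_of_ne hD] at h2
          exact ⟨π, (ih π).2 ⟨h1.2, h2⟩, by rw [h1.1]⟩
  | case3 C ρ b ih1 ih2 =>
    have hC : C ≠ S := fun h => hS (by simp [h])
    have ih1 := fun π => ih1 (fun h => hS (List.mem_cons_of_mem _ h)) π
    have ih2 := fun π => ih2 hS π
    rw [insSing, Finset.mem_union, Finset.mem_image, Finset.mem_image]
    constructor
    · rintro (⟨τ, hτ, rfl⟩ | ⟨τ, hτ, rfl⟩)
      · rw [ih1] at hτ
        simp [hC, hτ.1, hτ.2]
      · rw [ih2] at hτ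
        simp [hτ.1, hτ.2]
    · rintro ⟨h1, h2⟩
      rcases π with _ | ⟨D, π⟩
      · simp at h1
      · by_cases hD : D = S
        · subst hD
          refine Or.inr ⟨π, (ih2 π).2 ⟨by simpa using h1, by simpa using h2⟩, rfl⟩
        · rw [List.filter_cons_of_pos (by simp [hD]), List.cons.injEq] at h1
          rw [List.count_cons_of_ne hD] at h2
          exact Or.inl ⟨π, (ih1 π).2 ⟨h1.2, h2⟩, by rw [h1.1]⟩

theorem sum_insSing_zero {M : Type*} [AddCommMonoid M] (S C : Finset ℕ) (ρ : List (Finset ℕ))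
    (f : List (Finset ℕ) → M) :
    ∑ π ∈ insSing S (C :: ρ) 0, f π = ∑ π ∈ insSing S ρ 0, f (C :: π) := by
  rw [insSing, Finset.sum_image fun x _ y _ h => (List.cons.inj h).2]

theorem sum_insSing_succ {M : Type*} [AddCommMonoid M] {S C : Finset ℕ} (h : C ≠ S)
    (ρ : List (Finset ℕ)) (b : ℕ) (f : List (Finset ℕ) → M) :
    ∑ π ∈ insSing S (C :: ρ) (b + 1), f π =
      ∑ π ∈ insSing S ρ (b + 1), f (C :: π) + ∑ π ∈ insSing S (C :: ρ) b, f (S :: π) := by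
  rw [insSing, Finset.sum_union, Finset.sum_image fun x _ y _ h => (List.cons.inj h).2,
    Finset.sum_image fun x _ y _ h => (List.cons.inj h).2]
  rw [Finset.disjoint_left]
  intro π h1 h2
  obtain ⟨x, _, rfl⟩ := Finset.mem_image.1 h1
  obtain ⟨y, _, h3⟩ := Finset.mem_image.1 h2
  exact h (List.cons.inj h3).1.symm

theorem sum_map_of_mem_insSing {S : Finset ℕ} {ρ : List (Finset ℕ)} {b : ℕ}
    {π : List (Finset ℕ)} (hπ : π ∈ insSing S ρ b) {g : Finset ℕ → ℕ} (hg : g S = 0) :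
    (π.map g).sum = (ρ.map g).sum := by
  induction ρ, b using insSing.induct generalizing π with
  | case1 b =>
    rw [insSing, Finset.mem_singleton] at hπ
    simp [hπ, hg]
  | case2 C ρ ih =>
    rw [insSing, Finset.mem_image] at hπ
    obtain ⟨τ, hτ, rfl⟩ := hπ
    simp [ih hτ]
  | case3 C ρ b ih1 ih2 =>
    rw [insSing, Finset.mem_union, Finset.mem_image, Finset.mem_image] at hπ
    rcases hπ with ⟨τ, hτ, rfl⟩ | ⟨τ, hτ, rfl⟩
    · simp [ih1 hτ]
    · rw [List.map_cons, List.sum_cons, hg, zero_add, ih2 hτ]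

/-- The block `S` forms one pair with every block of `ρ` to its right and no other pairs. -/
structure LeftOne (p : Finset ℕ → Finset ℕ → ℕ) (S : Finset ℕ) (ρ : List (Finset ℕ)) : Prop where
  left : ∀ C ∈ ρ, p S C = 1
  right : ∀ C ∈ ρ, p C S = 0
  self : p S S = 0

theorem LeftOne.ne {p : Finset ℕ → Finset ℕ → ℕ} {S : Finset ℕ} {ρ : List (Finset ℕ)}
    (h : LeftOne p S ρ) {C : Finset ℕ} (hC : C ∈ ρ) : C ≠ S := by
  rintro rfl
  have := h.left C hC
  rw [h.self] at this
  omega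

theorem LeftOne.tail {p : Finset ℕ → Finset ℕ → ℕ} {S C : Finset ℕ} {ρ : List (Finset ℕ)}
    (h : LeftOne p S (C :: ρ)) : LeftOne p S ρ :=
  ⟨fun D hD => h.left D (List.mem_cons_of_mem _ hD),
    fun D hD => h.right D (List.mem_cons_of_mem _ hD), h.self⟩

theorem LeftOne.sum_eq {p : Finset ℕ → Finset ℕ → ℕ} {S : Finset ℕ} {ρ : List (Finset ℕ)}
    (h : LeftOne p S ρ) {b : ℕ} {π : List (Finset ℕ)} (hπ : π ∈ insSing S ρ b) :
    (π.map (p S)).sum = ρ.length := by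
  rw [sum_map_of_mem_insSing hπ h.self, List.map_congr_left h.left]
  simp

theorem pairSum_replicate {p : Finset ℕ → Finset ℕ → ℕ} {S : Finset ℕ} (h : p S S = 0) (b : ℕ) :
    pairSum p (List.replicate b S) = 0 := by
  induction b with
  | zero => rfl
  | succ b ih => simp [List.replicate_succ, pairSum, ih, h]

/-- Each copy of `S` contributes the number of blocks of `ρ` to its right, so this is the inversion
count of a shuffle. Splitting by the first block gives the Pascal recursion. -/
theorem sum_insSing {p : Finset ℕ → Finset ℕ → ℕ} {S : Finset ℕ} {ρ : List (Finset ℕ)}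
    (h : LeftOne p S ρ) (b : ℕ) : ∑ π ∈ insSing S ρ b, q ^ pairSum p π =
      q ^ pairSum p ρ * gaussBinom (ρ.length + b) b := by
  induction ρ, b using insSing.induct with
  | case1 b =>
    rw [insSing, Finset.sum_singleton, pairSum_replicate h.self]
    simp [pairSum]
  | case2 C ρ ih =>
    have ih := ih h.tail
    rw [gaussBinom_zero] at ih ⊢
    rw [sum_insSing_zero, pairSum, pow_add, mul_assoc, ← ih, Finset.mul_sum]
    refine Finset.sum_congr rfl fun π hπ => ?_
    rw [pairSum, pow_add, sum_map_of_mem_insSing hπ (h.right C List.mem_cons_self)]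
  | case3 C ρ b ih1 ih2 =>
    have ih1 := ih1 h.tail
    have ih2 := ih2 h
    rw [sum_insSing_succ (h.ne List.mem_cons_self)]
    have e1 : ∑ π ∈ insSing S ρ (b + 1), q ^ pairSum p (C :: π) = q ^ (ρ.map (p C)).sum *
        ∑ π ∈ insSing S ρ (b + 1), q ^ pairSum p π := by
      rw [Finset.mul_sum]
      refine Finset.sum_congr rfl fun π hπ => ?_
      rw [pairSum, pow_add, sum_map_of_mem_insSing hπ (h.right C List.mem_cons_self)]
    have e2 : ∑ π ∈ insSing S (C :: ρ) b, q ^ pairSum p (S :: π) = q ^ (ρ.length + 1) *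
        ∑ π ∈ insSing S (C :: ρ) b, q ^ pairSum p π := by
      rw [Finset.mul_sum]
      refine Finset.sum_congr rfl fun π hπ => ?_
      rw [pairSum, pow_add, h.sum_eq hπ, List.length_cons]
    have hp := gaussBinom_pascal' (ρ.length + 1) b
    rw [e1, e2, ih1, ih2, List.length_cons, pairSum, pow_add,
      show ρ.length + 1 + (b + 1) = ρ.length + 1 + b + 1 by ring, hp,
      show ρ.length + (b + 1) = ρ.length + 1 + b by ring]
    ring

/-! ### Zeros in the first or last block, and insertion of singletons. -/

/-- The letter `0` lies in the leftmost block. -/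
def ZeroFirst (π : List (Finset ℕ)) : Prop := ∃ B ∈ π.head?, 0 ∈ B

/-- The letter `0` lies in the rightmost block. -/
def ZeroLast (π : List (Finset ℕ)) : Prop := ∃ B ∈ π.getLast?, 0 ∈ B

theorem zeroFirst_cons (B : Finset ℕ) (π : List (Finset ℕ)) : ZeroFirst (B :: π) ↔ 0 ∈ B := by
  simp [ZeroFirst]

theorem not_zeroFirst_nil : ¬ ZeroFirst [] := by simp [ZeroFirst]

theorem zeroLast_singleton (B : Finset ℕ) : ZeroLast [B] ↔ 0 ∈ B := by
  simp [ZeroLast]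

theorem not_zeroLast_nil : ¬ ZeroLast [] := by simp [ZeroLast]

theorem zeroLast_cons (B : Finset ℕ) {π : List (Finset ℕ)} (h : π ≠ []) :
    ZeroLast (B :: π) ↔ ZeroLast π := by
  obtain ⟨C, π, rfl⟩ := List.exists_cons_of_ne_nil h
  rw [ZeroLast, ZeroLast, List.getLast?_cons_cons]

theorem not_zeroFirst_replicate {S : Finset ℕ} (h : 0 ∉ S) (b : ℕ) :
    ¬ ZeroFirst (List.replicate b S) := by
  rcases b with _ | b
  · exact not_zeroFirst_nil
  · rwa [List.replicate_succ, zeroFirst_cons]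

theorem not_zeroLast_replicate {S : Finset ℕ} (h : 0 ∉ S) (b : ℕ) :
    ¬ ZeroLast (List.replicate b S) := by
  rintro ⟨B, hB, h0⟩
  have := List.mem_of_mem_getLast? hB
  rw [List.eq_of_mem_replicate this] at h0
  exact h h0

open Classical in
-- As `0 ∉ S`, the first block of `ρ` has to stay first, so the copies are shuffled with the
-- remaining `ρ.length - 1` blocks only.
theorem sum_insSing_zeroFirst {p : Finset ℕ → Finset ℕ → ℕ} {S : Finset ℕ}
    {ρ : List (Finset ℕ)} (h : LeftOne p S ρ) (h0 : 0 ∉ S) (b : ℕ) :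
    (∑ π ∈ insSing S ρ b, if ZeroFirst π then q ^ pairSum p π else 0) =
      if ZeroFirst ρ then q ^ pairSum p ρ * gaussBinom (ρ.length - 1 + b) b else 0 := by
  rcases ρ with _ | ⟨C, ρ⟩
  · rw [if_neg not_zeroFirst_nil, insSing, Finset.sum_singleton,
      if_neg (not_zeroFirst_replicate h0 b)]
  · have e : (∑ π ∈ insSing S (C :: ρ) b, if ZeroFirst π then q ^ pairSum p π else 0) =
        ∑ π ∈ insSing S ρ b, if 0 ∈ C then q ^ pairSum p (C :: π) else 0 := by
      rcases b with _ | b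
      · rw [sum_insSing_zero]
        simp only [zeroFirst_cons]
      · rw [sum_insSing_succ (h.ne List.mem_cons_self)]
        simp only [zeroFirst_cons, h0, if_false, Finset.sum_const_zero, add_zero]
    rw [e]
    simp only [zeroFirst_cons]
    split_ifs with hC
    · rw [List.length_cons, Nat.add_sub_cancel, pairSum, pow_add, mul_assoc,
        ← sum_insSing h.tail b, Finset.mul_sum]
      refine Finset.sum_congr rfl fun π hπ => ?_
      rw [pairSum, pow_add, sum_map_of_mem_insSing hπ (h.right C List.mem_cons_self)]
    · exact Finset.sum_const_zero

theorem insSing_cons_ne_nil {S C : Finset ℕ} {ρ : List (Finset ℕ)} {b : ℕ}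
    {π : List (Finset ℕ)} (hπ : π ∈ insSing S (C :: ρ) b) : π ≠ [] := by
  rintro rfl
  rcases b with _ | b <;> simp [insSing] at hπ

open Classical in
-- The last block of `ρ` has to stay last. All `b` copies precede it, whence the factor `q^b`, and
-- are shuffled with the other blocks.
theorem sum_insSing_zeroLast {p : Finset ℕ → Finset ℕ → ℕ} {S : Finset ℕ}
    {ρ : List (Finset ℕ)} (h : LeftOne p S ρ) (h0 : 0 ∉ S) (b : ℕ) :
    (∑ π ∈ insSing S ρ b, if ZeroLast π then q ^ pairSum p π else 0) =
      if ZeroLast ρ then q ^ pairSum p ρ * (q ^ b * gaussBinom (ρ.length - 1 + b) b) else 0 := by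
  induction ρ, b using insSing.induct with
  | case1 b =>
    rw [if_neg not_zeroLast_nil, insSing, Finset.sum_singleton,
      if_neg (not_zeroLast_replicate h0 b)]
  | case2 C ρ ih =>
    have ih := ih h.tail
    rw [sum_insSing_zero]
    rcases ρ with _ | ⟨D, ρ⟩
    · rw [insSing, Finset.sum_singleton]
      simp [zeroLast_singleton]
    · rw [zeroLast_cons C (List.cons_ne_nil D ρ)]
      rw [gaussBinom_zero] at ih ⊢
      have e1 : (∑ π ∈ insSing S (D :: ρ) 0, if ZeroLast (C :: π) then
          q ^ pairSum p (C :: π) else 0) = q ^ ((D :: ρ).map (p C)).sum *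
          ∑ π ∈ insSing S (D :: ρ) 0, if ZeroLast π then q ^ pairSum p π else 0 := by
        rw [Finset.mul_sum]
        refine Finset.sum_congr rfl fun π hπ => ?_
        rw [zeroLast_cons C (insSing_cons_ne_nil hπ), pairSum, pow_add,
          sum_map_of_mem_insSing hπ (h.right C List.mem_cons_self), mul_ite, mul_zero]
      rw [e1, ih, show pairSum p (C :: D :: ρ) = ((D :: ρ).map (p C)).sum + pairSum p (D :: ρ)
        from rfl, pow_add, mul_ite, mul_zero]
      simp only [mul_assoc]
  | case3 C ρ b ih1 ih2 =>
    have ih1 := ih1 h.tail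
    have ih2 := ih2 h
    rw [sum_insSing_succ (h.ne List.mem_cons_self)]
    have e2 : (∑ π ∈ insSing S (C :: ρ) b, if ZeroLast (S :: π) then
        q ^ pairSum p (S :: π) else 0) = q ^ (ρ.length + 1) *
        ∑ π ∈ insSing S (C :: ρ) b, if ZeroLast π then q ^ pairSum p π else 0 := by
      rw [Finset.mul_sum]
      refine Finset.sum_congr rfl fun π hπ => ?_
      rw [zeroLast_cons S (insSing_cons_ne_nil hπ), pairSum, pow_add, h.sum_eq hπ,
        List.length_cons, mul_ite, mul_zero]
    rw [e2, ih2]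
    rcases ρ with _ | ⟨D, ρ⟩
    -- If `C` is the only block of `ρ` and comes first, a copy of `S` ends the list, so no such list
    -- has a zero in its last block.
    · have e3 : (∑ π ∈ insSing S [] (b + 1), if ZeroLast (C :: π) then
          q ^ pairSum p (C :: π) else 0) = 0 := by
        rw [insSing, Finset.sum_singleton, List.replicate_succ,
          zeroLast_cons C (List.cons_ne_nil _ _), ← List.replicate_succ,
          if_neg (not_zeroLast_replicate h0 _)]
      rw [e3, zero_add]
      simp only [List.length_cons, List.length_nil, zero_add, Nat.sub_self, gaussBinom_self]
      rw [mul_ite, mul_zero, Nat.succ_eq_add_one]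
      congr 1
      ring
    · have e1 : (∑ π ∈ insSing S (D :: ρ) (b + 1), if ZeroLast (C :: π) then
          q ^ pairSum p (C :: π) else 0) = q ^ ((D :: ρ).map (p C)).sum *
          ∑ π ∈ insSing S (D :: ρ) (b + 1), if ZeroLast π then q ^ pairSum p π else 0 := by
        rw [Finset.mul_sum]
        refine Finset.sum_congr rfl fun π hπ => ?_
        rw [zeroLast_cons C (insSing_cons_ne_nil hπ), pairSum, pow_add,
          sum_map_of_mem_insSing hπ (h.right C List.mem_cons_self), mul_ite, mul_zero]
      rw [e1, ih1, zeroLast_cons C (List.cons_ne_nil D ρ)]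
      split_ifs with hz
      · have hp := gaussBinom_pascal' (ρ.length + 1) b
        simp only [List.length_cons, Nat.add_sub_cancel]
        rw [show ρ.length + 1 + (b + 1) = ρ.length + 1 + b + 1 by ring, hp,
          show ρ.length + (b + 1) = ρ.length + 1 + b by ring,
          show pairSum p (C :: D :: ρ) = ((D :: ρ).map (p C)).sum + pairSum p (D :: ρ) from rfl,
          Nat.succ_eq_add_one]
        ring
      · simp

/-! ### Adding a letter to existing blocks -/

/-- All lists obtained from `ρ` by adding the letter `N` to `a` of its blocks. -/
def addLetter (N : ℕ) : List (Finset ℕ) → ℕ → Finset (List (Finset ℕ))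
  | [], 0 => {[]}
  | [], _ + 1 => ∅
  | C :: ρ, 0 => (addLetter N ρ 0).image (List.cons C)
  | C :: ρ, a + 1 => (addLetter N ρ (a + 1)).image (List.cons C) ∪
      (addLetter N ρ a).image (List.cons (insert N C))

theorem mem_addLetter {N : ℕ} {ρ : List (Finset ℕ)} (hN : ∀ C ∈ ρ, N ∉ C) (a : ℕ)
    (π : List (Finset ℕ)) :
    π ∈ addLetter N ρ a ↔ π.map (fun D => D.erase N) = ρ ∧ mult N π = a := by
  induction ρ, a using addLetter.induct generalizing π with
  | case1 =>
    rw [addLetter, Finset.mem_singleton, List.map_eq_nil_iff]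
    exact ⟨fun h => ⟨h, by rw [h]; rfl⟩, fun h => h.1⟩
  | case2 a =>
    rw [addLetter, List.map_eq_nil_iff]
    refine ⟨fun h => absurd h (Finset.notMem_empty _), ?_⟩
    rintro ⟨rfl, h⟩
    simp [mult] at h
  | case3 C ρ ih =>
    have hC : N ∉ C := hN C List.mem_cons_self
    have ih := fun π => ih (fun D hD => hN D (List.mem_cons_of_mem _ hD)) π
    rw [addLetter, Finset.mem_image]
    constructor
    · rintro ⟨τ, hτ, rfl⟩
      obtain ⟨h1, h2⟩ := (ih τ).1 hτ
      rw [List.map_cons, h1, Finset.erase_eq_of_notMem hC]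
      refine ⟨rfl, ?_⟩
      rw [mult, List.countP_cons_of_neg (by simpa using hC)]
      exact h2
    · rintro ⟨h1, h2⟩
      rcases π with _ | ⟨D, π⟩
      · simp at h1
      · rw [List.map_cons, List.cons.injEq] at h1
        by_cases hD : N ∈ D
        · rw [mult, List.countP_cons_of_pos (by simpa using hD)] at h2
          omega
        · rw [mult, List.countP_cons_of_neg (by simpa using hD)] at h2
          rw [Finset.erase_eq_of_notMem hD] at h1
          exact ⟨π, (ih π).2 ⟨h1.2, h2⟩, by rw [h1.1]⟩
  | case4 C ρ a ih1 ih2 =>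
    have hC : N ∉ C := hN C List.mem_cons_self
    have ih1 := fun π => ih1 (fun D hD => hN D (List.mem_cons_of_mem _ hD)) π
    have ih2 := fun π => ih2 (fun D hD => hN D (List.mem_cons_of_mem _ hD)) π
    rw [addLetter, Finset.mem_union, Finset.mem_image, Finset.mem_image]
    constructor
    · rintro (⟨τ, hτ, rfl⟩ | ⟨τ, hτ, rfl⟩)
      · obtain ⟨h1, h2⟩ := (ih1 τ).1 hτ
        rw [List.map_cons, h1, Finset.erase_eq_of_notMem hC]
        refine ⟨rfl, ?_⟩
        rw [mult, List.countP_cons_of_neg (by simpa using hC)]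
        exact h2
      · obtain ⟨h1, h2⟩ := (ih2 τ).1 hτ
        rw [List.map_cons, h1, Finset.erase_insert hC]
        refine ⟨rfl, ?_⟩
        rw [mult, List.countP_cons_of_pos (by simp)]
        exact congrArg (· + 1) h2
    · rintro ⟨h1, h2⟩
      rcases π with _ | ⟨D, π⟩
      · simp at h1
      · rw [List.map_cons, List.cons.injEq] at h1
        by_cases hD : N ∈ D
        · rw [mult, List.countP_cons_of_pos (by simpa using hD)] at h2
          refine Or.inr ⟨π, (ih2 π).2 ⟨h1.2, Nat.succ.inj h2⟩, ?_⟩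
          rw [← h1.1, Finset.insert_erase hD]
        · rw [mult, List.countP_cons_of_neg (by simpa using hD)] at h2
          rw [Finset.erase_eq_of_notMem hD] at h1
          exact Or.inl ⟨π, (ih1 π).2 ⟨h1.2, h2⟩, by rw [h1.1]⟩

theorem forall₂_of_mem_addLetter {N : ℕ} {ρ : List (Finset ℕ)} {a : ℕ} {π : List (Finset ℕ)}
    (h : π ∈ addLetter N ρ a) : List.Forall₂ (fun D C => D = C ∨ D = insert N C) π ρ := by
  induction ρ, a using addLetter.induct generalizing π with
  | case1 =>
    rw [addLetter, Finset.mem_singleton] at h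
    rw [h]
    exact List.Forall₂.nil
  | case2 a => exact absurd h (Finset.notMem_empty _)
  | case3 C ρ ih =>
    rw [addLetter, Finset.mem_image] at h
    obtain ⟨τ, hτ, rfl⟩ := h
    exact List.Forall₂.cons (Or.inl rfl) (ih hτ)
  | case4 C ρ a ih1 ih2 =>
    rw [addLetter, Finset.mem_union, Finset.mem_image, Finset.mem_image] at h
    rcases h with ⟨τ, hτ, rfl⟩ | ⟨τ, hτ, rfl⟩
    · exact List.Forall₂.cons (Or.inl rfl) (ih1 hτ)
    · exact List.Forall₂.cons (Or.inr rfl) (ih2 hτ)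

/-- The sum of the weights attached to the blocks containing `N`. -/
def letterWeight (N : ℕ) : List (Finset ℕ) → List ℕ → ℕ
  | B :: π, w :: ws => (if N ∈ B then w else 0) + letterWeight N π ws
  | _, _ => 0

open Polynomial in
-- Each block independently receives `N` (factor `q^w X`) or does not (factor `1`).
theorem sum_addLetter {N : ℕ} {ρ : List (Finset ℕ)} (hN : ∀ C ∈ ρ, N ∉ C) (a : ℕ)
    (ws : List ℕ) (hw : ws.length = ρ.length) :
    ∑ π ∈ addLetter N ρ a, q ^ letterWeight N π ws =
      ((ws.map fun w => (1 + C (q ^ w) * X : Kqt[X])).prod).coeff a := by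
  induction ρ, a using addLetter.induct generalizing ws with
  | case1 =>
    obtain rfl := List.length_eq_zero_iff.1 hw
    simp [addLetter, letterWeight]
  | case2 a =>
    obtain rfl := List.length_eq_zero_iff.1 hw
    simp [addLetter, Polynomial.coeff_one]
  | case3 C ρ ih =>
    obtain ⟨w, ws, rfl⟩ := List.exists_cons_of_length_eq_add_one hw
    have hC : N ∉ C := hN C List.mem_cons_self
    have ih := ih (fun D hD => hN D (List.mem_cons_of_mem _ hD)) ws (by simpa using hw)
    rw [addLetter, Finset.sum_image fun x _ y _ h => (List.cons.inj h).2]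
    simp only [letterWeight, hC, if_false, zero_add]
    rw [ih, List.map_cons, List.prod_cons, mul_coeff_zero]
    simp
  | case4 C ρ a ih1 ih2 =>
    obtain ⟨w, ws, rfl⟩ := List.exists_cons_of_length_eq_add_one hw
    have hC : N ∉ C := hN C List.mem_cons_self
    have ih1 := ih1 (fun D hD => hN D (List.mem_cons_of_mem _ hD)) ws (by simpa using hw)
    have ih2 := ih2 (fun D hD => hN D (List.mem_cons_of_mem _ hD)) ws (by simpa using hw)
    rw [addLetter, Finset.sum_union, Finset.sum_image fun x _ y _ h => (List.cons.inj h).2,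
      Finset.sum_image fun x _ y _ h => (List.cons.inj h).2]
    · simp only [letterWeight, hC, if_false, zero_add, Finset.mem_insert_self, if_true, pow_add]
      rw [← Finset.mul_sum, ih1, ih2, List.map_cons, List.prod_cons, add_mul, one_mul, coeff_add,
        mul_assoc, coeff_C_mul, coeff_X_mul]
    · rw [Finset.disjoint_left]
      intro π h1 h2
      obtain ⟨x, _, rfl⟩ := Finset.mem_image.1 h1
      obtain ⟨y, _, h3⟩ := Finset.mem_image.1 h2
      refine hC ?_
      rw [← (List.cons.inj h3).1]
      exact Finset.mem_insert_self _ _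

/-- The list of blocks of `ρ`, each with the number of pairs created by a new largest letter in
that block, if a new letter in the left block `B` of a pair `B, C` creates `α B C` pairs and a new
letter in the right block creates `β B C` pairs. -/
def ranks (α β : Finset ℕ → Finset ℕ → ℕ) : List (Finset ℕ) → List (Finset ℕ × ℕ)
  | [] => []
  | C :: ρ => (C, (ρ.map (α C)).sum) :: (ranks α β ρ).map fun x => (x.1, β C x.1 + x.2)

theorem map_fst_ranks (α β : Finset ℕ → Finset ℕ → ℕ) (ρ : List (Finset ℕ)) :
    (ranks α β ρ).map Prod.fst = ρ := by
  induction ρ with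
  | nil => rfl
  | cons C ρ ih =>
    rw [ranks, List.map_cons, List.map_map]
    exact congrArg (List.cons C) ih

/-- How a statistic behaves when a new largest letter is added to one or both blocks of a pair, and
the fact that the numbers of pairs created by adding the letter to the different blocks of a
sequence are `0, 1, 2, …` in some order. -/
structure InsertionRule (p α β : Finset ℕ → Finset ℕ → ℕ) : Prop where
  insert_left : ∀ (N : ℕ) (B C : Finset ℕ), (∀ x ∈ B, x < N) → (∀ x ∈ C, x < N) →
    p (insert N B) C = p B C + α B C
  insert_right : ∀ (N : ℕ) (B C : Finset ℕ), (∀ x ∈ B, x < N) → (∀ x ∈ C, x < N) →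
    p B (insert N C) = p B C + β B C
  insert_both : ∀ (N : ℕ) (B C : Finset ℕ), (∀ x ∈ B, x < N) → (∀ x ∈ C, x < N) →
    p (insert N B) (insert N C) = p B C + α B C + β B C
  empty_left : ∀ C, p ∅ C = 0
  empty_right : ∀ B, p B ∅ = 0
  alpha_empty_left : ∀ C : Finset ℕ, C.Nonempty → α ∅ C = 1
  alpha_empty_right : ∀ B, α B ∅ = 0
  beta_empty_left : ∀ C, β ∅ C = 0
  beta_empty_right : ∀ B, β B ∅ = 0
  ranks_eq : ∀ ρ : List (Finset ℕ), (∀ C ∈ ρ, C.Nonempty) →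
    (((ranks α β ρ).map Prod.snd : List ℕ) : Multiset ℕ) = Multiset.range ρ.length

section

variable {p α β : Finset ℕ → Finset ℕ → ℕ}

theorem letterWeight_add (N : ℕ) (π : List (Finset ℕ)) (L : List (Finset ℕ × ℕ))
    (g : Finset ℕ → ℕ) : letterWeight N π (L.map fun x => g x.1 + x.2) =
      letterWeight N π (L.map fun x => g x.1) + letterWeight N π (L.map Prod.snd) := by
  induction π generalizing L with
  | nil => rfl
  | cons B π ih =>
    rcases L with _ | ⟨x, L⟩
    · rfl
    · simp only [List.map_cons, letterWeight]
      rw [ih]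
      split_ifs <;> omega

theorem InsertionRule.sum_map_eq (h : InsertionRule p α β) {N : ℕ} {C D : Finset ℕ}
    (hC : ∀ x ∈ C, x < N) (hD : D = C ∨ D = insert N C) {π ρ : List (Finset ℕ)}
    (hρ : ∀ B ∈ ρ, ∀ x ∈ B, x < N)
    (hπ : List.Forall₂ (fun D C => D = C ∨ D = insert N C) π ρ) :
    (π.map (p D)).sum = (ρ.map (p C)).sum + (if N ∈ D then (ρ.map (α C)).sum else 0) +
      letterWeight N π (ρ.map (β C)) := by
  have hNC : N ∉ C := fun h => lt_irrefl _ (hC N h)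
  induction hπ with
  | nil => simp [letterWeight]
  | @cons D' C' π ρ hD' hπ ih =>
    have hC' := hρ C' List.mem_cons_self
    have hNC' : N ∉ C' := fun h => lt_irrefl _ (hC' N h)
    have ih := ih fun B hB => hρ B (List.mem_cons_of_mem _ hB)
    simp only [List.map_cons, List.sum_cons, letterWeight]
    rw [ih]
    rcases hD with rfl | rfl <;> rcases hD' with rfl | rfl
    · simp only [hNC, hNC', if_false]
      omega
    · have := h.insert_right N D C' hC hC'
      simp only [hNC, if_false, Finset.mem_insert_self, if_true]
      omega
    · have := h.insert_left N C D' hC hC'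
      simp only [hNC', if_false, Finset.mem_insert_self, if_true]
      omega
    · have := h.insert_both N C C' hC hC'
      simp only [Finset.mem_insert_self, if_true]
      omega

/-- Two new letters create no pair with each other (`insert_both`), so the contributions add up. For
the head block, the `α` terms form its own weight, while its `β` terms go to the weights of the
blocks on its right. -/
theorem InsertionRule.pairSum_eq (h : InsertionRule p α β) {N : ℕ} {π ρ : List (Finset ℕ)}
    (hρ : ∀ B ∈ ρ, ∀ x ∈ B, x < N)
    (hπ : List.Forall₂ (fun D C => D = C ∨ D = insert N C) π ρ) :
    pairSum p π = pairSum p ρ + letterWeight N π ((ranks α β ρ).map Prod.snd) := by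
  induction hπ with
  | nil => rfl
  | @cons D C π ρ hD hπ ih =>
    have hρ' : ∀ B ∈ ρ, ∀ x ∈ B, x < N := fun B hB => hρ B (List.mem_cons_of_mem _ hB)
    have e : ((ranks α β (C :: ρ)).map Prod.snd) = (ρ.map (α C)).sum ::
        (ranks α β ρ).map fun x => β C x.1 + x.2 := by
      rw [ranks, List.map_cons, List.map_map]
      rfl
    have e2 : ((ranks α β ρ).map fun x => β C x.1) = ρ.map (β C) := by
      conv_rhs => rw [← map_fst_ranks α β ρ, List.map_map]
      rfl
    rw [pairSum, pairSum, ih hρ', h.sum_map_eq (hρ C List.mem_cons_self) hD hρ' hπ, e,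
      letterWeight, letterWeight_add, e2]
    omega

/-- The weights are `0, …, ρ.length - 1` in some order, so the choice of `a` blocks gives an
elementary symmetric function of `1, q, q², …`. -/
theorem InsertionRule.sum_addLetter (h : InsertionRule p α β) {N : ℕ} {ρ : List (Finset ℕ)}
    (hρ : ∀ B ∈ ρ, ∀ x ∈ B, x < N) (hne : ∀ B ∈ ρ, B.Nonempty) (a : ℕ) :
    ∑ π ∈ addLetter N ρ a, q ^ pairSum p π = q ^ pairSum p ρ * qElem ρ.length a := by
  have h1 : ∀ π ∈ addLetter N ρ a, q ^ pairSum p π =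
      q ^ pairSum p ρ * q ^ letterWeight N π ((ranks α β ρ).map Prod.snd) := by
    intro π hπ
    rw [h.pairSum_eq hρ (forall₂_of_mem_addLetter hπ), pow_add]
  have hlen : ((ranks α β ρ).map Prod.snd).length = ρ.length := by
    conv_rhs => rw [← map_fst_ranks α β ρ]
    rw [List.length_map, List.length_map]
  rw [Finset.sum_congr rfl h1, ← Finset.mul_sum,
    OrdSetPart.sum_addLetter (fun C hC hN => lt_irrefl _ (hρ C hC N hN)) a _ hlen,
    ← coeff_prod_range_qElem, ← Multiset.prod_coe, ← Multiset.map_coe, h.ranks_eq ρ hne]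
  rfl

/-- `{N}` is the empty block with `N` added, so the clauses of the rule for empty blocks apply. -/
theorem InsertionRule.leftOne (h : InsertionRule p α β) {N : ℕ} {π ρ : List (Finset ℕ)}
    (hρ : ∀ B ∈ ρ, ∀ x ∈ B, x < N) (hne : ∀ B ∈ ρ, B.Nonempty)
    (hπ : List.Forall₂ (fun D C => D = C ∨ D = insert N C) π ρ) : LeftOne p {N} π := by
  have h0 : ∀ x ∈ (∅ : Finset ℕ), x < N := fun x hx => absurd hx (Finset.notMem_empty x)
  have hmem : ∀ D ∈ π, ∃ C ∈ ρ, D = C ∨ D = insert N C := by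
    clear hρ hne
    induction hπ with
    | nil => simp
    | @cons D C π ρ hD hπ ih =>
      intro B hB
      rcases List.mem_cons.1 hB with rfl | hB
      · exact ⟨C, List.mem_cons_self, hD⟩
      · obtain ⟨C', hC', hB⟩ := ih B hB
        exact ⟨C', List.mem_cons_of_mem _ hC', hB⟩
  have hs : ({N} : Finset ℕ) = insert N ∅ := rfl
  rw [hs]
  refine ⟨fun D hD => ?_, fun D hD => ?_, ?_⟩
  · obtain ⟨C, hC, rfl | rfl⟩ := hmem D hD
    · rw [h.insert_left N _ _ h0 (hρ _ hC), h.empty_left, h.alpha_empty_left _ (hne _ hC)]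
    · rw [h.insert_both N _ _ h0 (hρ _ hC), h.empty_left, h.alpha_empty_left _ (hne _ hC),
        h.beta_empty_left]
  · obtain ⟨C, hC, rfl | rfl⟩ := hmem D hD
    · rw [h.insert_right N _ _ (hρ _ hC) h0, h.empty_right, h.beta_empty_right]
    · rw [h.insert_both N _ _ (hρ _ hC) h0, h.empty_right, h.beta_empty_right,
        h.alpha_empty_right]
  · rw [h.insert_both N _ _ h0 h0, h.empty_right, h.beta_empty_right, h.alpha_empty_right]

end

/-! ### The statistics `inv` and `dinv` -/

theorem invPair_eq (B : Finset ℕ) {C : Finset ℕ} (hC : C.Nonempty) :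
    invPair B C = (B.filter fun i => C.min' hC < i).card := by
  have : ((B ×ˢ C).filter fun p => p.2 < p.1 ∧ ∀ c ∈ C, p.2 ≤ c) =
      (B.filter fun i => C.min' hC < i) ×ˢ {C.min' hC} := by
    ext ⟨i, j⟩
    simp only [Finset.mem_filter, Finset.mem_product, Finset.mem_singleton]
    constructor
    · rintro ⟨⟨hi, hj⟩, hlt, hmin⟩
      have : j = C.min' hC :=
        le_antisymm (hmin _ (Finset.min'_mem C hC)) (Finset.min'_le C j hj)
      exact ⟨⟨hi, this ▸ hlt⟩, this⟩
    · rintro ⟨⟨hi, hlt⟩, rfl⟩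
      exact ⟨⟨hi, Finset.min'_mem C hC⟩, hlt, fun c hc => Finset.min'_le C c hc⟩
  rw [invPair, this, Finset.card_product, Finset.card_singleton, mul_one]

theorem invPair_empty_right (B : Finset ℕ) : invPair B ∅ = 0 := by simp [invPair]

theorem invPair_empty_left (C : Finset ℕ) : invPair ∅ C = 0 := by simp [invPair]

theorem invPair_insert_left {N : ℕ} {B C : Finset ℕ} (hB : ∀ x ∈ B, x < N)
    (hC : ∀ x ∈ C, x < N) :
    invPair (insert N B) C = invPair B C + if C.Nonempty then 1 else 0 := by
  rcases C.eq_empty_or_nonempty with rfl | hne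
  · simp [invPair_empty_right]
  · rw [if_pos hne, invPair_eq _ hne, invPair_eq _ hne, Finset.filter_insert,
      if_pos (hC _ (Finset.min'_mem C hne)), Finset.card_insert_of_notMem]
    intro h
    exact lt_irrefl _ (hB N (Finset.mem_filter.1 h).1)

theorem invPair_insert_right {N : ℕ} {B C : Finset ℕ} (hB : ∀ x ∈ B, x ≤ N)
    (hC : ∀ x ∈ C, x < N) : invPair B (insert N C) = invPair B C := by
  rw [invPair_eq B (Finset.insert_nonempty N C)]
  rcases C.eq_empty_or_nonempty with rfl | hne
  · rw [invPair_empty_right, Finset.card_eq_zero, Finset.filter_eq_empty_iff]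
    intro x hx
    have := hB x hx
    simp
    omega
  · rw [invPair_eq B hne, Finset.min'_insert N C hne,
      min_eq_right (hC _ (Finset.min'_mem C hne)).le]

/-- A new largest letter exceeds the minimum of every block to its right, and never affects pairs as
a letter of the right block. Its weight is thus the number of blocks to its right. -/
theorem insertionRule_inv :
    InsertionRule invPair (fun _ C => if C.Nonempty then 1 else 0) fun _ _ => 0 where
  insert_left N B C hB hC := invPair_insert_left hB hC
  insert_right N B C hB hC := invPair_insert_right (fun x hx => (hB x hx).le) hC
  insert_both N B C hB hC := by
    rw [invPair_insert_right _ hC, invPair_insert_left hB hC, add_zero]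
    intro x hx
    rcases Finset.mem_insert.1 hx with rfl | hx
    exacts [le_rfl, (hB x hx).le]
  empty_left := invPair_empty_left
  empty_right := invPair_empty_right
  alpha_empty_left C hC := if_pos hC
  alpha_empty_right B := by simp
  beta_empty_left _ := rfl
  beta_empty_right _ := rfl
  ranks_eq ρ hρ := by
    induction ρ with
    | nil => rfl
    | cons C ρ ih =>
      have hρ' : ∀ D ∈ ρ, D.Nonempty := fun D hD => hρ D (List.mem_cons_of_mem _ hD)
      have e : (ρ.map fun D : Finset ℕ => if D.Nonempty then 1 else 0).sum = ρ.length := by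
        rw [List.map_congr_left (g := fun _ => 1) fun D hD => if_pos (hρ' D hD)]
        simp
      rw [ranks, List.map_cons, List.map_map, e, List.length_cons, Multiset.range_succ, ← ih hρ',
        Multiset.cons_coe]
      congr 2
      refine List.map_congr_left fun x _ => ?_
      exact zero_add _

theorem rank_insert_of_lt {N : ℕ} {C : Finset ℕ} {j : ℕ} (hj : j < N) :
    rank (insert N C) j = rank C j := by
  rw [rank, rank, Finset.filter_insert, if_neg (by omega)]

theorem rank_insert_self {N : ℕ} {C : Finset ℕ} (hC : ∀ x ∈ C, x < N) :
    rank (insert N C) N = C.card := by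
  rw [rank, Finset.filter_insert, if_neg (lt_irrefl _), Finset.filter_true_of_mem hC]

theorem rank_lt_card {C : Finset ℕ} {j : ℕ} (hj : j ∈ C) : rank C j < C.card := by
  refine Finset.card_lt_card (Finset.filter_ssubset.2 ⟨j, hj, lt_irrefl _⟩)

theorem rank_lt_rank {C : Finset ℕ} {i j : ℕ} (hi : i ∈ C) (hij : i < j) :
    rank C i < rank C j := by
  refine Finset.card_lt_card ?_
  rw [Finset.ssubset_iff_of_subset]
  · exact ⟨i, by simp [hi, hij], by simp⟩
  · intro x hx
    rw [Finset.mem_filter] at hx ⊢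
    exact ⟨hx.1, hx.2.trans hij⟩

theorem rank_injOn (C : Finset ℕ) : Set.InjOn (rank C) C := by
  intro i hi j hj h
  by_contra hne
  rcases Nat.lt_or_gt_of_ne hne with hlt | hlt
  · have := rank_lt_rank hi hlt
    omega
  · have := rank_lt_rank hj hlt
    omega

theorem image_rank (C : Finset ℕ) : C.image (rank C) = Finset.range C.card := by
  refine Finset.eq_of_subset_of_card_le (fun x hx => ?_) ?_
  · obtain ⟨j, hj, rfl⟩ := Finset.mem_image.1 hx
    exact Finset.mem_range.2 (rank_lt_card hj)
  · rw [Finset.card_image_of_injOn (rank_injOn C), Finset.card_range]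

theorem card_filter_rank_eq (C : Finset ℕ) (r : ℕ) :
    (C.filter fun j => rank C j = r).card = if r < C.card then 1 else 0 := by
  split_ifs with h
  · rw [← Finset.mem_range, ← image_rank] at h
    obtain ⟨j, hj, rfl⟩ := Finset.mem_image.1 h
    rw [Finset.card_eq_one]
    refine ⟨j, ?_⟩
    ext i
    rw [Finset.mem_filter, Finset.mem_singleton]
    exact ⟨fun hi => rank_injOn C hi.1 hj hi.2, fun hi => by rw [hi]; exact ⟨hj, rfl⟩⟩
  · rw [Finset.card_eq_zero, Finset.filter_eq_empty_iff]
    intro j hj hr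
    have := rank_lt_card hj
    omega

/-- The indicator of a diagonal inversion. -/
def dinvInd (B C : Finset ℕ) (i j : ℕ) : ℕ :=
  if (j < i ∧ rank C j = rank B i) ∨ (i < j ∧ rank C j = rank B i + 1) then 1 else 0

theorem dinvPair_eq_sum (B C : Finset ℕ) :
    dinvPair B C = ∑ i ∈ B, ∑ j ∈ C, dinvInd B C i j := by
  rw [dinvPair, Finset.card_filter, Finset.sum_product]
  rfl

theorem dinvInd_congr {B B' C C' : Finset ℕ} {i j : ℕ} (h1 : rank B i = rank B' i)
    (h2 : rank C j = rank C' j) : dinvInd B C i j = dinvInd B' C' i j := by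
  rw [dinvInd, dinvInd, h1, h2]

theorem sum_dinvInd_left {N : ℕ} {B B' C C' : Finset ℕ} (hC : ∀ x ∈ C, x < N)
    (h1 : rank B' N = B.card) (h2 : ∀ j ∈ C, rank C' j = rank C j) :
    ∑ j ∈ C, dinvInd B' C' N j = if B.card < C.card then 1 else 0 := by
  rw [← card_filter_rank_eq, Finset.card_filter]
  refine Finset.sum_congr rfl fun j hj => ?_
  have := hC j hj
  rw [dinvInd, h1, h2 j hj]
  refine if_congr ?_ rfl rfl
  omega

theorem sum_dinvInd_right {N : ℕ} {B B' C C' : Finset ℕ} (hB : ∀ x ∈ B, x < N)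
    (h1 : rank C' N = C.card) (h2 : ∀ i ∈ B, rank B' i = rank B i) :
    ∑ i ∈ B, dinvInd B' C' i N = if 1 ≤ C.card ∧ C.card ≤ B.card then 1 else 0 := by
  have e : (∑ i ∈ B, dinvInd B' C' i N) = ∑ i ∈ B, if C.card = rank B i + 1 then 1 else 0 := by
    refine Finset.sum_congr rfl fun i hi => ?_
    have := hB i hi
    rw [dinvInd, h1, h2 i hi]
    refine if_congr ?_ rfl rfl
    omega
  rw [e, ← Finset.card_filter]
  rcases Nat.eq_zero_or_pos C.card with h0 | h0
  · rw [h0, if_neg (by omega), Finset.card_eq_zero, Finset.filter_eq_empty_iff]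
    intro i _
    omega
  · obtain ⟨c, hc⟩ := Nat.exists_eq_succ_of_ne_zero h0.ne'
    have := card_filter_rank_eq B c
    rw [hc]
    simp only [Nat.succ_eq_add_one, add_left_inj]
    simp only [eq_comm (a := c)]
    rw [this]
    refine if_congr ?_ rfl rfl
    omega

theorem notMem_of_forall_lt {N : ℕ} {B : Finset ℕ} (hB : ∀ x ∈ B, x < N) : N ∉ B :=
  fun h => lt_irrefl _ (hB N h)

/-- The threshold `t` strengthens the induction: larger blocks always carry the smaller weights. A
new leftmost block `C` leaves the `n` larger blocks alone, takes the weight `n`, and shifts the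
blocks of size at most `C.card` up by one. -/
theorem ranks_dinv (ρ : List (Finset ℕ)) (hρ : ∀ C ∈ ρ, C.Nonempty) (t : ℕ) :
    (((ranks (fun B C => if B.card < C.card then 1 else 0)
      (fun B C => if 1 ≤ C.card ∧ C.card ≤ B.card then 1 else 0) ρ :
        Multiset (Finset ℕ × ℕ)).filter fun x => t ≤ x.1.card).map Prod.snd) =
      Multiset.range (ρ.countP fun C => t ≤ C.card) := by
  induction ρ generalizing t with
  | nil => rfl
  | cons C ρ ih =>
    have hρ' : ∀ D ∈ ρ, D.Nonempty := fun D hD => hρ D (List.mem_cons_of_mem _ hD)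
    have ih := ih hρ'
    set β : Finset ℕ → Finset ℕ → ℕ :=
      fun B C => if 1 ≤ C.card ∧ C.card ≤ B.card then 1 else 0 with hβ
    set M : Multiset (Finset ℕ × ℕ) :=
      (ranks (fun B C => if B.card < C.card then 1 else 0) β ρ : Multiset (Finset ℕ × ℕ)) with hM
    have hpos : ∀ x ∈ M, 1 ≤ x.1.card := by
      intro x hx
      refine Finset.card_pos.2 (hρ' _ ?_)
      rw [← map_fst_ranks (fun B C => if B.card < C.card then 1 else 0) β ρ]
      exact List.mem_map_of_mem (by simpa [hM] using hx)
    have hsum : ∀ σ : List (Finset ℕ), (σ.map fun D => if C.card < D.card then 1 else 0).sum =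
        σ.countP fun D => C.card + 1 ≤ D.card := by
      intro σ
      induction σ with
      | nil => rfl
      | cons D σ ih =>
        rw [List.map_cons, List.sum_cons, ih, List.countP_cons, add_comm]
        simp
    have e : ((ranks (fun B C => if B.card < C.card then 1 else 0) β (C :: ρ) :
        List (Finset ℕ × ℕ)) : Multiset (Finset ℕ × ℕ)) =
        (C, ρ.countP fun D => C.card + 1 ≤ D.card) ::ₘ
          M.map fun x => (x.1, β C x.1 + x.2) := by
      rw [ranks, hsum, ← Multiset.cons_coe, hM, Multiset.map_coe]
    have hbig : ∀ t, C.card < t →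
        (((M.map fun x => (x.1, β C x.1 + x.2)).filter fun x => t ≤ x.1.card).map Prod.snd) =
          Multiset.range (ρ.countP fun C => t ≤ C.card) := by
      intro t ht
      rw [← ih t, Multiset.filter_map, Multiset.map_map]
      refine Multiset.map_congr rfl fun x hx => ?_
      have h1 : t ≤ x.1.card := (Multiset.mem_filter.1 hx).2
      have : β C x.1 = 0 := if_neg (by omega)
      simp [this]
    rw [e]
    rcases Nat.lt_or_ge C.card t with ht | ht
    · rw [Multiset.filter_cons_of_neg _ (by simpa using ht), hbig t ht, List.countP_cons_of_neg]
      simpa using ht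
    · rw [Multiset.filter_cons_of_pos _ (by simpa using ht), Multiset.map_cons,
        List.countP_cons_of_pos (by simpa using ht)]
      have hsplit : ∀ Q : Multiset (Finset ℕ × ℕ), (Q.filter fun x => t ≤ x.1.card) =
          (Q.filter fun x => C.card + 1 ≤ x.1.card) +
            Q.filter fun x => t ≤ x.1.card ∧ x.1.card ≤ C.card := by
        intro Q
        rw [← Multiset.filter_add_not (fun x => C.card + 1 ≤ x.1.card)
          (Q.filter fun x => t ≤ x.1.card), Multiset.filter_filter, Multiset.filter_filter]
        congr 1 <;> refine Multiset.filter_congr fun x _ => ?_ <;> omega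
      set n := ρ.countP fun D => C.card + 1 ≤ D.card with hn
      have hle : n ≤ ρ.countP fun D => t ≤ D.card := by
        refine List.countP_mono_left fun D _ hD => ?_
        simp only [decide_eq_true_eq] at hD ⊢
        omega
      obtain ⟨r, hr⟩ := Nat.exists_eq_add_of_le hle
      -- The induction hypothesis at `C.card + 1` gives the larger blocks the weights below `n`;
      -- cancelling these from the hypothesis at `t` leaves `n, …, n + r - 1`.
      have hsmall : ((M.filter fun x => t ≤ x.1.card ∧ x.1.card ≤ C.card).map Prod.snd) =
          (Multiset.range r).map (n + ·) := by
        have h1 := ih t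
        rw [hsplit, Multiset.map_add, ih (C.card + 1), hr, Multiset.range_add] at h1
        exact add_left_cancel h1
      have hsmall' : (((M.map fun x => (x.1, β C x.1 + x.2)).filter
          fun x => t ≤ x.1.card ∧ x.1.card ≤ C.card).map Prod.snd) =
          (Multiset.range r).map (n + 1 + ·) := by
        have : (Multiset.range r).map (n + 1 + ·) =
            ((Multiset.range r).map (n + ·)).map (1 + ·) := by
          rw [Multiset.map_map]
          refine Multiset.map_congr rfl fun x _ => ?_
          simp only [Function.comp_apply]
          omega
        rw [this, ← hsmall, Multiset.filter_map, Multiset.map_map, Multiset.map_map]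
        refine Multiset.map_congr rfl fun x hx => ?_
        obtain ⟨hxM, hx⟩ := Multiset.mem_filter.1 hx
        have h2 : β C x.1 = 1 := if_pos ⟨hpos x hxM, hx.2⟩
        simp [h2]
      rw [hsplit, Multiset.map_add, hbig _ (Nat.lt_succ_self _), hsmall', hr,
        show n + r + 1 = (n + 1) + r by ring, Multiset.range_add, Multiset.range_succ,
        Multiset.cons_add]

/-- In `insert N B` the letter `N` has rank `B.card`. On the left it forms a primary inversion with
the letter of that rank in `C`, if there is one; in the right block it forms a secondary inversion
with the letter of rank `C.card - 1` of `B`, if there is one. -/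
theorem insertionRule_dinv :
    InsertionRule dinvPair (fun B C => if B.card < C.card then 1 else 0)
      (fun B C => if 1 ≤ C.card ∧ C.card ≤ B.card then 1 else 0) where
  insert_left N B C hB hC := by
    rw [dinvPair_eq_sum, dinvPair_eq_sum, Finset.sum_insert (notMem_of_forall_lt hB),
      sum_dinvInd_left hC (rank_insert_self hB) fun _ _ => rfl, add_comm]
    congr 1
    refine Finset.sum_congr rfl fun i hi => Finset.sum_congr rfl fun j _ => ?_
    exact dinvInd_congr (rank_insert_of_lt (hB i hi)) rfl
  insert_right N B C hB hC := by
    rw [dinvPair_eq_sum, dinvPair_eq_sum]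
    simp only [Finset.sum_insert (notMem_of_forall_lt hC)]
    rw [Finset.sum_add_distrib, sum_dinvInd_right hB (rank_insert_self hC) fun _ _ => rfl, add_comm]
    congr 1
    refine Finset.sum_congr rfl fun i _ => Finset.sum_congr rfl fun j hj => ?_
    exact dinvInd_congr rfl (rank_insert_of_lt (hC j hj))
  insert_both N B C hB hC := by
    rw [dinvPair_eq_sum, dinvPair_eq_sum, Finset.sum_insert (notMem_of_forall_lt hB)]
    simp only [Finset.sum_insert (notMem_of_forall_lt hC)]
    rw [Finset.sum_add_distrib, sum_dinvInd_right hB (rank_insert_self hC)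
      fun i hi => rank_insert_of_lt (hB i hi),
      sum_dinvInd_left hC (rank_insert_self hB) fun j hj => rank_insert_of_lt (hC j hj)]
    have h0 : dinvInd (insert N B) (insert N C) N N = 0 := if_neg (by omega)
    have e : (∑ i ∈ B, ∑ j ∈ C, dinvInd (insert N B) (insert N C) i j) =
        ∑ i ∈ B, ∑ j ∈ C, dinvInd B C i j :=
      Finset.sum_congr rfl fun i hi => Finset.sum_congr rfl fun j hj =>
        dinvInd_congr (rank_insert_of_lt (hB i hi)) (rank_insert_of_lt (hC j hj))
    rw [h0, e]
    ring
  empty_left C := by simp [dinvPair]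
  empty_right B := by simp [dinvPair]
  alpha_empty_left C hC := if_pos (by simpa using hC)
  alpha_empty_right B := by simp
  beta_empty_left C := if_neg (by rw [Finset.card_empty]; omega)
  beta_empty_right B := if_neg (by simp)
  ranks_eq ρ hρ := by
    have h := ranks_dinv ρ hρ 0
    simpa using h

/-! ### Ordered multiset partitions with given content -/

theorem mult_nil (i : ℕ) : mult i [] = 0 := rfl

theorem mult_cons (i : ℕ) (B : Finset ℕ) (π : List (Finset ℕ)) :
    mult i (B :: π) = (if i ∈ B then 1 else 0) + mult i π := by
  rw [mult, mult, List.countP_cons, add_comm]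
  simp

theorem mult_pos {i : ℕ} {π : List (Finset ℕ)} {B : Finset ℕ} (hB : B ∈ π) (hi : i ∈ B) :
    mult i π ≠ 0 :=
  (List.countP_pos_iff.2 ⟨B, hB, by simpa using hi⟩).ne'

/-- The sequences of `B` nonempty blocks with `e i` letters `i` for every `i`. -/
def contentSet (e : ℕ →₀ ℕ) (B : ℕ) : Set (List (Finset ℕ)) :=
  {π | (∀ C ∈ π, C.Nonempty) ∧ (∀ i, mult i π = e i) ∧ π.length = B}

theorem mem_support_of_mem_contentSet {e : ℕ →₀ ℕ} {B : ℕ} {π : List (Finset ℕ)}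
    (h : π ∈ contentSet e B) {C : Finset ℕ} (hC : C ∈ π) {i : ℕ} (hi : i ∈ C) : i ∈ e.support := by
  rw [Finsupp.mem_support_iff, ← h.2.1 i]
  exact mult_pos hC hi

theorem finite_contentSet (e : ℕ →₀ ℕ) (B : ℕ) : (contentSet e B).Finite := by
  refine ((List.finite_length_eq {C : Finset ℕ // C ⊆ e.support} B).image
    (List.map Subtype.val)).subset ?_
  intro π h
  have hU : ∀ C ∈ π, C ⊆ e.support := fun C hC i hi => mem_support_of_mem_contentSet h hC hi
  refine ⟨π.attachWith _ hU, ?_, ?_⟩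
  · simpa using h.2.2
  · simp

/-- The finite set `contentSet e B`. -/
def content (e : ℕ →₀ ℕ) (B : ℕ) : Finset (List (Finset ℕ)) := (finite_contentSet e B).toFinset

theorem mem_content {e : ℕ →₀ ℕ} {B : ℕ} {π : List (Finset ℕ)} :
    π ∈ content e B ↔ (∀ C ∈ π, C.Nonempty) ∧ (∀ i, mult i π = e i) ∧ π.length = B :=
  Set.Finite.mem_toFinset _

theorem length_filter_ne (S : Finset ℕ) (π : List (Finset ℕ)) :
    π.length = (π.filter fun D => !decide (D = S)).length + π.count S := by
  induction π with
  | nil => rfl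
  | cons D π ih =>
    by_cases h : D = S
    · simp [h, ih]
      omega
    · simp [h, ih]
      omega

theorem mult_filter_ne (i : ℕ) (S : Finset ℕ) (π : List (Finset ℕ)) :
    mult i π = mult i (π.filter fun D => !decide (D = S)) + if i ∈ S then π.count S else 0 := by
  induction π with
  | nil => simp [mult]
  | cons D π ih =>
    by_cases h : D = S
    · subst h
      rw [mult_cons, ih, List.filter_cons_of_neg (by simp), List.count_cons_self]
      split_ifs <;> omega
    · rw [mult_cons, ih, List.filter_cons_of_pos (by simp [h]), List.count_cons_of_ne h,
        mult_cons]
      omega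

theorem mult_map_erase {i N : ℕ} (h : i ≠ N) (π : List (Finset ℕ)) :
    mult i (π.map fun D => D.erase N) = mult i π := by
  rw [mult, mult, List.countP_map]
  congr 1
  funext D
  simp [h]

theorem mult_map_erase_self (N : ℕ) (π : List (Finset ℕ)) :
    mult N (π.map fun D => D.erase N) = 0 := by
  rw [mult, List.countP_map, List.countP_eq_zero]
  simp

/-- Removing the largest letter `N` of the content. -/
theorem sum_content {M : Type*} [AddCommMonoid M] {N : ℕ} {e : ℕ →₀ ℕ}
    (hN : ∀ i ∈ e.support, i < N) (j B : ℕ) (f : List (Finset ℕ) → M) :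
    ∑ π ∈ content (Finsupp.single N j + e) B, f π =
      ∑ b ∈ (Finset.range (j + 1)).filter (· ≤ B), ∑ ρ ∈ content e (B - b),
        ∑ σ ∈ addLetter N ρ (j - b), ∑ π ∈ insSing {N} σ b, f π := by
  have heN : e N = 0 := by
    by_contra h
    exact lt_irrefl _ (hN N (Finsupp.mem_support_iff.2 h))
  have hρN : ∀ {B ρ}, ρ ∈ content e B → ∀ C ∈ ρ, N ∉ C := fun h C hC hNC =>
    lt_irrefl _ (hN N (mem_support_of_mem_contentSet (mem_content.1 h) hC hNC))
  -- A block `{N}` of `σ` would leave an empty block in `ρ`.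
  have hσN : ∀ {ρ σ : List (Finset ℕ)}, (∀ C ∈ ρ, C.Nonempty) →
      σ.map (fun D => D.erase N) = ρ → {N} ∉ σ := by
    rintro ρ σ h rfl hs
    have := h _ (List.mem_map_of_mem hs)
    simp at this
  simp only [Finset.sum_sigma']
  symm
  -- The inverse deletes the blocks `{N}`, of which there are `b`, and then erases `N` from the
  -- others.
  refine Finset.sum_bij'
    (fun x _ => x.2.2.2)
    (fun π _ => ⟨π.count {N}, (π.filter fun D => !decide (D = {N})).map fun D => D.erase N,
      π.filter fun D => !decide (D = {N}), π⟩) ?_ ?_ ?_ ?_ ?_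
  · rintro ⟨b, ρ, σ, π⟩ h
    simp only [Finset.mem_sigma, Finset.mem_filter, Finset.mem_range] at h
    obtain ⟨⟨hbj, hbB⟩, hρ, hσ, hπ⟩ := h
    have hNρ := hρN hρ
    rw [mem_addLetter hNρ] at hσ
    rw [mem_content] at hρ
    have hS := hσN hρ.1 hσ.1
    rw [mem_insSing hS] at hπ
    refine mem_content.2 ⟨fun C hC => ?_, fun i => ?_, ?_⟩
    · by_cases hCN : C = {N}
      · simp [hCN]
      · have hCσ : C ∈ σ := by
          rw [← hπ.1]
          exact List.mem_filter.2 ⟨hC, by simpa using hCN⟩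
        have := hρ.1 (C.erase N) (by rw [← hσ.1]; exact List.mem_map_of_mem hCσ)
        exact this.mono (Finset.erase_subset _ _)
    · rw [mult_filter_ne i {N} π, hπ.1, hπ.2, Finsupp.add_apply]
      by_cases hi : i = N
      · subst hi
        rw [hσ.2, heN]
        simp
        omega
      · rw [← mult_map_erase hi σ, hσ.1, hρ.2.1]
        simp [hi]
    · change π.length = B
      rw [length_filter_ne {N} π, hπ.1, hπ.2]
      have : σ.length = ρ.length := by rw [← hσ.1, List.length_map]
      rw [this, hρ.2.2]
      omega
  · intro π h
    rw [mem_content] at h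
    have hmN : mult N π = j := by
      rw [h.2.1, Finsupp.add_apply, heN]
      simp
    have h1 := mult_filter_ne N {N} π
    rw [hmN, if_pos (Finset.mem_singleton_self N)] at h1
    have h2 := length_filter_ne {N} π
    rw [h.2.2] at h2
    have hρ : ((π.filter fun D => !decide (D = {N})).map fun D => D.erase N) ∈
        content e (B - π.count {N}) := by
      refine mem_content.2 ⟨fun C hC => ?_, fun i => ?_, ?_⟩
      · obtain ⟨D, hD, rfl⟩ := List.mem_map.1 hC
        rw [List.mem_filter] at hD
        rw [Finset.nonempty_iff_ne_empty, ne_eq, Finset.erase_eq_empty_iff]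
        rintro (h0 | h0)
        · exact (h.1 D hD.1).ne_empty h0
        · simp [h0] at hD
      · by_cases hi : i = N
        · rw [hi, mult_map_erase_self, heN]
        · have h3 := mult_filter_ne i {N} π
          rw [h.2.1, if_neg (by simpa using hi), Finsupp.add_apply] at h3
          rw [mult_map_erase hi, ← add_zero (mult i _), ← h3]
          simp [Ne.symm hi]
      · rw [List.length_map]
        omega
    simp only [Finset.mem_sigma, Finset.mem_filter, Finset.mem_range]
    refine ⟨⟨by omega, by omega⟩, hρ, (mem_addLetter (hρN hρ) _ _).2 ⟨rfl, by omega⟩, ?_⟩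
    exact (mem_insSing (hσN (mem_content.1 hρ).1 rfl) _ _).2 ⟨rfl, rfl⟩
  · rintro ⟨b, ρ, σ, π⟩ h
    simp only [Finset.mem_sigma, Finset.mem_filter, Finset.mem_range] at h
    obtain ⟨⟨hbj, hbB⟩, hρ, hσ, hπ⟩ := h
    rw [mem_addLetter (hρN hρ)] at hσ
    rw [mem_insSing (hσN (mem_content.1 hρ).1 hσ.1)] at hπ
    obtain ⟨rfl, rfl⟩ := hπ
    obtain ⟨rfl, -⟩ := hσ
    rfl
  · intro π _
    rfl
  · intro x _
    rfl

/-! ### Recursions for the generating functions. -/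

open Classical in
/-- The generating function of `pairSum p` over the sequences of given content with property `Q`. -/
def genFun (p : Finset ℕ → Finset ℕ → ℕ) (Q : List (Finset ℕ) → Prop) (e : ℕ →₀ ℕ) (B : ℕ) : Kqt :=
  ∑ π ∈ content e B, if Q π then q ^ pairSum p π else 0

open Classical in
-- The property `Q` ignores `N` in existing blocks, so that stage only gives the factor `qElem`;
-- inserting `b` singletons gives `κ`.
theorem genFun_rec {p α β : Finset ℕ → Finset ℕ → ℕ} (h : InsertionRule p α β)
    {Q : List (Finset ℕ) → Prop} {N : ℕ} {κ : ℕ → ℕ → Kqt}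
    (hadd : ∀ σ ρ, List.Forall₂ (fun D C => D = C ∨ D = insert N C) σ ρ → (Q σ ↔ Q ρ))
    (hins : ∀ σ b, LeftOne p {N} σ → (∑ π ∈ insSing {N} σ b, if Q π then q ^ pairSum p π else 0) =
      if Q σ then q ^ pairSum p σ * κ σ.length b else 0)
    {e : ℕ →₀ ℕ} (hN : ∀ i ∈ e.support, i < N) (j B : ℕ) :
    genFun p Q (Finsupp.single N j + e) B = ∑ b ∈ (Finset.range (j + 1)).filter (· ≤ B),
      qElem (B - b) (j - b) * κ (B - b) b * genFun p Q e (B - b) := by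
  rw [genFun, sum_content hN]
  refine Finset.sum_congr rfl fun b _ => ?_
  rw [genFun, Finset.mul_sum]
  refine Finset.sum_congr rfl fun ρ hρ => ?_
  rw [mem_content] at hρ
  have hlt : ∀ C ∈ ρ, ∀ x ∈ C, x < N := fun C hC x hx =>
    hN x (mem_support_of_mem_contentSet hρ hC hx)
  have e1 : ∀ σ ∈ addLetter N ρ (j - b),
      (∑ π ∈ insSing {N} σ b, if Q π then q ^ pairSum p π else 0) =
      if Q ρ then κ (B - b) b * q ^ pairSum p σ else 0 := by
    intro σ hσ
    have hσρ := forall₂_of_mem_addLetter hσ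
    rw [hins σ b (h.leftOne hlt hρ.1 hσρ), hσρ.length_eq, hρ.2.2, mul_comm]
    exact if_congr (hadd σ ρ hσρ) rfl rfl
  rw [Finset.sum_congr rfl e1]
  split_ifs
  · rw [← Finset.mul_sum, h.sum_addLetter hlt hρ.1, hρ.2.2]
    ring
  · simp

theorem zeroFirst_congr {N : ℕ} (hN : N ≠ 0) {σ ρ : List (Finset ℕ)}
    (h : List.Forall₂ (fun D C => D = C ∨ D = insert N C) σ ρ) : ZeroFirst σ ↔ ZeroFirst ρ := by
  rcases h with _ | ⟨h, _⟩
  · rfl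
  · rw [zeroFirst_cons, zeroFirst_cons]
    rcases h with rfl | rfl
    · rfl
    · simp [hN.symm]

theorem zeroLast_congr {N : ℕ} (hN : N ≠ 0) {σ ρ : List (Finset ℕ)}
    (h : List.Forall₂ (fun D C => D = C ∨ D = insert N C) σ ρ) : ZeroLast σ ↔ ZeroLast ρ := by
  induction h with
  | nil => rfl
  | @cons D C σ ρ hD h ih =>
    rcases h with _ | ⟨h1, h2⟩
    · rw [zeroLast_singleton, zeroLast_singleton]
      rcases hD with rfl | rfl
      · rfl
      · simp [hN.symm]
    · rw [zeroLast_cons _ (List.cons_ne_nil _ _), zeroLast_cons _ (List.cons_ne_nil _ _), ih]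

theorem genFun_rec_true {p α β : Finset ℕ → Finset ℕ → ℕ} (h : InsertionRule p α β) {N : ℕ}
    {e : ℕ →₀ ℕ} (hN : ∀ i ∈ e.support, i < N) (j B : ℕ) :
    genFun p (fun _ => True) (Finsupp.single N j + e) B =
      ∑ b ∈ (Finset.range (j + 1)).filter (· ≤ B), qElem (B - b) (j - b) *
        gaussBinom (B - b + b) b * genFun p (fun _ => True) e (B - b) := by
  refine genFun_rec (κ := fun L b => gaussBinom (L + b) b) h (fun _ _ _ => Iff.rfl)
    (fun σ b hσ => ?_) hN j B
  simp only [if_true]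
  exact sum_insSing hσ b

theorem genFun_rec_zeroFirst {p α β : Finset ℕ → Finset ℕ → ℕ} (h : InsertionRule p α β) {N : ℕ}
    (hN0 : N ≠ 0) {e : ℕ →₀ ℕ} (hN : ∀ i ∈ e.support, i < N) (j B : ℕ) :
    genFun p ZeroFirst (Finsupp.single N j + e) B =
      ∑ b ∈ (Finset.range (j + 1)).filter (· ≤ B), qElem (B - b) (j - b) *
        (1 ^ b * gaussBinom (B - b - 1 + b) b) * genFun p ZeroFirst e (B - b) := by
  refine genFun_rec (κ := fun L b => 1 ^ b * gaussBinom (L - 1 + b) b) h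
    (fun _ _ => zeroFirst_congr hN0) (fun σ b hσ => ?_) hN j B
  rw [one_pow, one_mul]
  exact sum_insSing_zeroFirst hσ (by simpa using hN0.symm) b

theorem genFun_rec_zeroLast {p α β : Finset ℕ → Finset ℕ → ℕ} (h : InsertionRule p α β) {N : ℕ}
    (hN0 : N ≠ 0) {e : ℕ →₀ ℕ} (hN : ∀ i ∈ e.support, i < N) (j B : ℕ) :
    genFun p ZeroLast (Finsupp.single N j + e) B =
      ∑ b ∈ (Finset.range (j + 1)).filter (· ≤ B), qElem (B - b) (j - b) *
        (q ^ b * gaussBinom (B - b - 1 + b) b) * genFun p ZeroLast e (B - b) := by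
  exact genFun_rec (κ := fun L b => q ^ b * gaussBinom (L - 1 + b) b) h
    (fun _ _ => zeroLast_congr hN0)
    (fun σ b hσ => sum_insSing_zeroLast hσ (by simpa using hN0.symm) b) hN j B

theorem mult_replicate_zero (m i : ℕ) :
    mult i (List.replicate m {0}) = Finsupp.single 0 m i := by
  rw [mult, List.countP_replicate]
  by_cases h : i = 0
  · simp [h]
  · simp [h]

theorem content_single_zero (m B : ℕ) :
    content (Finsupp.single 0 m) B = if B = m then {List.replicate m {0}} else ∅ := by
  have key : ∀ π ∈ content (Finsupp.single 0 m) B, π = List.replicate m {0} := by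
    intro π h
    have hc := mem_content.1 h
    have h0 : ∀ C ∈ π, C = {0} := by
      intro C hC
      refine (hc.1 C hC).subset_singleton_iff.1 fun i hi => ?_
      have := mem_support_of_mem_contentSet hc hC hi
      by_contra hi0
      simp only [Finset.mem_singleton] at hi0
      simp [Ne.symm hi0] at this
    have h1 := List.eq_replicate_of_mem h0
    rw [h1]
    have h2 := hc.2.1 0
    rw [h1, mult_replicate_zero] at h2
    simp only [Finsupp.single_eq_same] at h2
    rw [h2]
  ext π
  split_ifs with hB
  · rw [Finset.mem_singleton]
    refine ⟨key π, ?_⟩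
    rintro rfl
    refine mem_content.2 ⟨fun C hC => ?_, mult_replicate_zero m, ?_⟩
    · rw [List.eq_of_mem_replicate hC]
      exact Finset.singleton_nonempty 0
    · rw [List.length_replicate, hB]
  · refine ⟨fun h => absurd ?_ hB, fun h => absurd h (Finset.notMem_empty _)⟩
    have := key π h
    rw [← (mem_content.1 h).2.2, this, List.length_replicate]

open Classical in
theorem genFun_single_zero {p : Finset ℕ → Finset ℕ → ℕ} (hp : p {0} {0} = 0)
    (Q : List (Finset ℕ) → Prop) (m B : ℕ) :
    genFun p Q (Finsupp.single 0 m) B =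
      if B = m ∧ Q (List.replicate m {0}) then 1 else 0 := by
  rw [genFun, content_single_zero]
  by_cases hB : B = m
  · rw [if_pos hB, Finset.sum_singleton, pairSum_replicate hp]
    simp [hB]
  · simp [hB]

theorem invPair_zero : invPair {0} {0} = 0 := by decide

theorem dinvPair_zero : dinvPair {0} {0} = 0 := by decide

/-- The generating function of `inv`. -/
def invGF (e : ℕ →₀ ℕ) (B : ℕ) : Kqt := genFun invPair (fun _ => True) e B

theorem invGF_single_zero (m B : ℕ) :
    invGF (Finsupp.single 0 m) B = if B = m then 1 else 0 := by
  rw [invGF, genFun_single_zero invPair_zero]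
  simp only [and_true]

theorem invGF_zero (B : ℕ) : invGF 0 B = if B = 0 then 1 else 0 := by
  rw [← invGF_single_zero, Finsupp.single_zero]

theorem invGF_rec {N : ℕ} {e : ℕ →₀ ℕ} (hN : ∀ i ∈ e.support, i < N) (j B : ℕ) :
    invGF (Finsupp.single N j + e) B = ∑ b ∈ (Finset.range (j + 1)).filter (· ≤ B),
      qElem (B - b) (j - b) * gaussBinom (B - b + b) b * invGF e (B - b) :=
  genFun_rec_true insertionRule_inv hN j B

/-- The recursion does not depend on which statistic satisfies the insertion rule. -/
theorem genFun_dinv_eq (e : ℕ →₀ ℕ) (B : ℕ) : genFun dinvPair (fun _ => True) e B = invGF e B := by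
  induction e using Finsupp.induction_on_max generalizing B with
  | zero =>
    have h1 := genFun_single_zero dinvPair_zero (fun _ => True) 0 B
    rw [Finsupp.single_zero] at h1
    rw [h1, invGF_zero]
    simp only [and_true]
  | single_add N j e hN hj ih =>
    rw [genFun_rec_true insertionRule_dinv hN, invGF_rec hN]
    exact Finset.sum_congr rfl fun b _ => by rw [ih]

/-- A generating function with weight `x^b [B-1 choose b]` in the place of `[B choose b]`. -/
theorem qNum_mul_eq_of_rec (x : Kqt) (G : (ℕ →₀ ℕ) → ℕ → Kqt) (h0 : ∀ e, G e 0 = 0)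
    (hbase : ∀ m B, m ≠ 0 → G (Finsupp.single 0 m) B = if B = m then 1 else 0)
    (hzero : ∀ B, G 0 B = 0)
    (hrec : ∀ N, N ≠ 0 → ∀ e : ℕ →₀ ℕ, (∀ i ∈ e.support, i < N) → ∀ j B,
      G (Finsupp.single N j + e) B = ∑ b ∈ (Finset.range (j + 1)).filter (· ≤ B),
        qElem (B - b) (j - b) * (x ^ b * gaussBinom (B - b - 1 + b) b) * G e (B - b))
    (e : ℕ →₀ ℕ) (B : ℕ) : x ^ e 0 * (qNum B * G e B) = x ^ B * (qNum (e 0) * invGF e B) := by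
  induction e using Finsupp.induction_on_max generalizing B with
  | zero => simp [hzero]
  | single_add N j e hN hj ih =>
    rcases eq_or_ne N 0 with rfl | hN0
    · obtain rfl : e = 0 := by
        rw [← Finsupp.support_eq_empty, Finset.eq_empty_iff_forall_notMem]
        exact fun i hi => absurd (hN i hi) (Nat.not_lt_zero i)
      rw [add_zero, hbase j B hj, invGF_single_zero]
      by_cases hB : B = j
      · simp [hB]
      · simp [hB]
    · rw [hrec N hN0 e hN, invGF_rec hN]
      have he : (Finsupp.single N j + e) 0 = e 0 := by
        simp [hN0]
      rw [he]
      simp only [Finset.mul_sum]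
      refine Finset.sum_congr rfl fun b hb => ?_
      have hbB := (Finset.mem_filter.1 hb).2
      obtain ⟨L, rfl⟩ := Nat.exists_eq_add_of_le' hbB
      rw [Nat.add_sub_cancel]
      have ih := ih L
      -- The truncated `L - 1` is harmless at `L = 0`, where `G` vanishes.
      rcases L with _ | L
      · rw [h0, mul_zero, mul_zero, pow_zero, one_mul] at ih
        rw [h0, mul_zero, mul_zero, mul_zero]
        linear_combination (x ^ (0 + b) * qElem 0 (j - b) * gaussBinom (0 + b) b) * ih
      -- This trades `[L+1+b]` for the `[L+1]` of the induction hypothesis, turning the weight of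
      -- `G` into that of `invGF`.
      · have h2 := qNum_mul_gaussBinom_pred L b
        rw [Nat.add_sub_cancel, pow_add x (L + 1) b]
        linear_combination (x ^ e 0 * qElem (L + 1) (j - b) * x ^ b * G e (L + 1)) * h2 +
          (x ^ b * qElem (L + 1) (j - b) * gaussBinom (L + 1 + b) b) * ih

theorem qNum_mul_inv_zeroFirst (e : ℕ →₀ ℕ) (B : ℕ) :
    qNum B * genFun invPair ZeroFirst e B = qNum (e 0) * invGF e B := by
  have h := qNum_mul_eq_of_rec 1 (genFun invPair ZeroFirst) ?_ ?_ ?_ ?_ e B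
  · simpa using h
  · intro e
    refine Finset.sum_eq_zero fun π hπ => if_neg ?_
    rw [List.length_eq_zero_iff.1 (mem_content.1 hπ).2.2]
    exact not_zeroFirst_nil
  · intro m B hm
    obtain ⟨m, rfl⟩ := Nat.exists_eq_succ_of_ne_zero hm
    rw [genFun_single_zero invPair_zero]
    simp [List.replicate_succ, zeroFirst_cons]
  · intro B
    have := genFun_single_zero invPair_zero ZeroFirst 0 B
    rw [Finsupp.single_zero] at this
    simp [this, not_zeroFirst_nil]
  · exact fun N hN0 e hN j B => genFun_rec_zeroFirst insertionRule_inv hN0 hN j B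

theorem qNum_mul_dinv_zeroLast (e : ℕ →₀ ℕ) (B : ℕ) :
    q ^ e 0 * (qNum B * genFun dinvPair ZeroLast e B) = q ^ B * (qNum (e 0) * invGF e B) := by
  refine qNum_mul_eq_of_rec q (genFun dinvPair ZeroLast) ?_ ?_ ?_ ?_ e B
  · intro e
    refine Finset.sum_eq_zero fun π hπ => if_neg ?_
    rw [List.length_eq_zero_iff.1 (mem_content.1 hπ).2.2]
    exact not_zeroLast_nil
  · intro m B hm
    obtain ⟨m, rfl⟩ := Nat.exists_eq_succ_of_ne_zero hm
    rw [genFun_single_zero dinvPair_zero]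
    have : ZeroLast (List.replicate (m + 1) {0}) := by
      rw [List.replicate_succ', ZeroLast]
      simp
    simp [this]
  · intro B
    have := genFun_single_zero dinvPair_zero ZeroLast 0 B
    rw [Finsupp.single_zero] at this
    simp [this, not_zeroLast_nil]
  · exact fun N hN0 e hN j B => genFun_rec_zeroLast insertionRule_dinv hN0 hN j B

/-! ### Inversion -/

theorem sum_range_filter_le {M : Type*} [AddCommMonoid M] (n b : ℕ) (φ : ℕ → M)
    (hφ : ∀ B, n ≤ B → φ B = 0) :
    (∑ B ∈ Finset.range n, if b ≤ B then φ B else 0) = ∑ L ∈ Finset.range n, φ (L + b) := by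
  have h1 : (∑ B ∈ Finset.range n, if b ≤ B then φ B else 0) =
      ∑ B ∈ Finset.range (b + n), if b ≤ B then φ B else 0 := by
    refine Finset.sum_subset (Finset.range_mono (by omega)) fun B _ hB => ?_
    rw [hφ B (by simpa using hB), ite_self]
  rw [h1, Finset.sum_range_add, Finset.sum_eq_zero, zero_add]
  · refine Finset.sum_congr rfl fun L _ => ?_
    rw [if_pos (by omega), add_comm]
  · intro B hB
    rw [if_neg]
    have := Finset.mem_range.1 hB
    omega

/-- Removing the largest letter, of multiplicity `j`, matches multiplication by `e_j`: the recursion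
has exactly the coefficients of `qElem_mul_qElem`. -/
theorem sum_qElem_mul_invGF (c : ℕ) (e : ℕ →₀ ℕ) :
    ∑ B ∈ Finset.range (c + 1), qElem c B * invGF e B = ((exps e).map (qElem c)).prod := by
  induction e using Finsupp.induction_on_max with
  | zero =>
    simp [invGF_zero, exps]
  | single_add N j e hN hj ih =>
    have hexp : exps (Finsupp.single N j + e) = j ::ₘ exps e := by
      have hNe : N ∉ e.support := fun h => lt_irrefl _ (hN N h)
      have heN : e N = 0 := Finsupp.notMem_support_iff.1 hNe
      unfold exps
      rw [Finsupp.support_single_add hNe hj, Finset.cons_val, Multiset.map_cons]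
      congr 1
      · simp [heN]
      · refine Multiset.map_congr rfl fun i hi => ?_
        have : N ≠ i := fun h => hNe (h ▸ hi)
        simp [this]
    have e1 : ∀ B, qElem c B * invGF (Finsupp.single N j + e) B = ∑ b ∈ Finset.range (j + 1),
        if b ≤ B then qElem c B * (qElem (B - b) (j - b) * gaussBinom (B - b + b) b *
          invGF e (B - b)) else 0 := by
      intro B
      rw [invGF_rec hN, Finset.sum_filter, Finset.mul_sum]
      refine Finset.sum_congr rfl fun b _ => ?_
      rw [mul_ite, mul_zero]
    rw [hexp, Multiset.map_cons, Multiset.prod_cons, ← ih]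
    simp only [e1]
    rw [Finset.sum_comm, Finset.mul_sum]
    have e2 : ∀ b ∈ Finset.range (j + 1), (∑ B ∈ Finset.range (c + 1),
        if b ≤ B then qElem c B * (qElem (B - b) (j - b) * gaussBinom (B - b + b) b *
          invGF e (B - b)) else 0) = ∑ L ∈ Finset.range (c + 1),
        qElem L (j - b) * gaussBinom (L + b) b * qElem c (L + b) * invGF e L := by
      intro b _
      rw [sum_range_filter_le]
      · refine Finset.sum_congr rfl fun L _ => ?_
        rw [Nat.add_sub_cancel]
        ring
      · intro B hB
        rw [qElem_of_lt hB, zero_mul]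
    rw [Finset.sum_congr rfl e2, Finset.sum_comm]
    refine Finset.sum_congr rfl fun L _ => ?_
    rw [← Finset.sum_mul, ← qElem_mul_qElem]
    ring

/-- At `c = B` the last term has the invertible coefficient `q^(B choose 2)`, and the earlier terms
are known. -/
theorem eq_of_sum_qElem_eq {u v : ℕ → Kqt}
    (h : ∀ c, ∑ B ∈ Finset.range (c + 1), qElem c B * u B =
      ∑ B ∈ Finset.range (c + 1), qElem c B * v B) (B : ℕ) : u B = v B := by
  induction B using Nat.strong_induction_on with
  | _ B ih =>
    have h1 := h B
    rw [Finset.sum_range_succ, Finset.sum_range_succ, Finset.sum_congr rfl fun C hC => by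
      rw [ih C (Finset.mem_range.1 hC)]] at h1
    refine mul_left_cancel₀ ?_ (add_left_cancel h1)
    rw [qElem, gaussBinom_self, mul_one]
    exact pow_ne_zero _ q_ne_zero

theorem prod_exps_consExp (c m : ℕ) (d : ℕ →₀ ℕ) :
    ((exps (consExp m d)).map (qElem c)).prod = qElem c m * ((exps d).map (qElem c)).prod := by
  rcases eq_or_ne m 0 with rfl | hm
  · rw [exps_consExp_zero, qElem_zero, one_mul]
  · rw [exps_consExp hm, Multiset.map_cons, Multiset.prod_cons]

/-- The product that determines `invGF` sees only the multiset of multiplicities; this is the source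
of all symmetry. -/
theorem invGF_consExp_congr {d d' : ℕ →₀ ℕ} (h : exps d = exps d') (m B : ℕ) :
    invGF (consExp m d) B = invGF (consExp m d') B := by
  refine eq_of_sum_qElem_eq (fun c => ?_) B
  rw [sum_qElem_mul_invGF, sum_qElem_mul_invGF, prod_exps_consExp, prod_exps_consExp, h]

/-- Linearizing `e_m e_j` inside the determining product replaces `m` zeros and `j` next letters by
`m + s` zeros. -/
theorem invGF_consExp_consExp (m j : ℕ) (d : ℕ →₀ ℕ) (B : ℕ) :
    invGF (consExp m (consExp j d)) B = ∑ s ∈ Finset.range (j + 1),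
      qElem m (j - s) * gaussBinom (m + s) s * invGF (consExp (m + s) d) B := by
  refine eq_of_sum_qElem_eq
    (v := fun B => ∑ s ∈ Finset.range (j + 1),
      qElem m (j - s) * gaussBinom (m + s) s * invGF (consExp (m + s) d) B) (fun c => ?_) B
  rw [sum_qElem_mul_invGF, prod_exps_consExp, prod_exps_consExp, ← mul_assoc, qElem_mul_qElem,
    Finset.sum_mul]
  simp only [Finset.mul_sum]
  rw [Finset.sum_comm]
  refine Finset.sum_congr rfl fun s _ => ?_
  rw [mul_assoc, ← prod_exps_consExp, ← sum_qElem_mul_invGF, Finset.mul_sum]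
  refine Finset.sum_congr rfl fun B _ => ?_
  ring

/-! ### Removing the zero of the first block -/

theorem invPair_insert_zero_left (B C : Finset ℕ) : invPair (insert 0 B) C = invPair B C := by
  rw [invPair, invPair]
  congr 1
  ext ⟨i, j⟩
  simp only [Finset.mem_filter, Finset.mem_product, Finset.mem_insert]
  constructor
  · rintro ⟨⟨rfl | hi, hj⟩, h⟩
    · omega
    · exact ⟨⟨hi, hj⟩, h⟩
  · rintro ⟨⟨hi, hj⟩, h⟩
    exact ⟨⟨Or.inr hi, hj⟩, h⟩

/-- Adding a zero to the first block. -/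
def zeroHead : List (Finset ℕ) → List (Finset ℕ)
  | [] => []
  | H :: π => insert 0 H :: π

theorem pairSum_zeroHead (π : List (Finset ℕ)) :
    pairSum invPair (zeroHead π) = pairSum invPair π := by
  rcases π with _ | ⟨H, π⟩
  · rfl
  · rw [zeroHead, pairSum, pairSum]
    congr 2
    exact List.map_congr_left fun C _ => invPair_insert_zero_left H C

theorem pairSum_cons_zero (π : List (Finset ℕ)) :
    pairSum invPair ({0} :: π) = pairSum invPair π := by
  have : π.map (invPair {0}) = π.map fun _ => 0 := by
    refine List.map_congr_left fun C _ => ?_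
    have := invPair_insert_zero_left ∅ C
    rw [invPair_empty_left] at this
    exact this
  rw [pairSum, this]
  simp

open Classical in
-- A zero alone in the first block is removed with its block; otherwise it is erased, which leaves a
-- nonempty first block free of zeros.
theorem content_filter_zeroFirst (e : ℕ →₀ ℕ) (B : ℕ) :
    (content (Finsupp.single 0 1 + e) (B + 1)).filter ZeroFirst =
      (content e B).image (List.cons {0}) ∪
        ((content e (B + 1)).filter fun π => ¬ ZeroFirst π).image zeroHead := by
  ext π
  simp only [Finset.mem_union, Finset.mem_image, Finset.mem_filter, mem_content]
  constructor
  · rintro ⟨⟨h1, h2, h3⟩, h4⟩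
    rcases π with _ | ⟨H, π⟩
    · simp at h3
    rw [zeroFirst_cons] at h4
    have h1' := fun C hC => h1 C (List.mem_cons_of_mem _ hC)
    by_cases hH : H = {0}
    · subst hH
      refine Or.inl ⟨π, ⟨h1', fun i => ?_, by simpa using h3⟩, rfl⟩
      have := h2 i
      rw [mult_cons, Finsupp.add_apply] at this
      by_cases hi : i = 0
      · simp [hi] at this ⊢
        omega
      · simpa [hi] using this
    · refine Or.inr ⟨H.erase 0 :: π, ⟨⟨?_, fun i => ?_, by simpa using h3⟩, ?_⟩, ?_⟩
      · intro C hC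
        rcases List.mem_cons.1 hC with rfl | hC
        · rw [Finset.nonempty_iff_ne_empty, ne_eq, Finset.erase_eq_empty_iff]
          rintro (h0 | h0)
          · simp [h0] at h4
          · exact hH h0
        · exact h1' C hC
      · have := h2 i
        rw [mult_cons, Finsupp.add_apply] at this
        rw [mult_cons]
        by_cases hi : i = 0
        · simp [hi, h4] at this ⊢
          omega
        · simpa [hi] using this
      · rw [zeroFirst_cons]
        exact Finset.notMem_erase 0 H
      · rw [zeroHead, Finset.insert_erase h4]
  · rintro (⟨τ, ⟨h1, h2, h3⟩, rfl⟩ | ⟨τ, ⟨⟨h1, h2, h3⟩, h4⟩, rfl⟩)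
    · refine ⟨⟨?_, fun i => ?_, by simpa using h3⟩, by simp [zeroFirst_cons]⟩
      · intro C hC
        rcases List.mem_cons.1 hC with rfl | hC
        · exact Finset.singleton_nonempty 0
        · exact h1 C hC
      · rw [mult_cons, h2, Finsupp.add_apply]
        by_cases hi : i = 0
        · simp [hi]
        · simp [hi]
    · rcases τ with _ | ⟨H, τ⟩
      · simp at h3
      rw [zeroFirst_cons] at h4
      refine ⟨⟨?_, fun i => ?_, by simpa [zeroHead] using h3⟩, by simp [zeroHead, zeroFirst_cons]⟩
      · intro C hC
        rcases List.mem_cons.1 hC with rfl | hC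
        · exact Finset.insert_nonempty 0 H
        · exact h1 C (List.mem_cons_of_mem _ hC)
      · rw [zeroHead, mult_cons, Finsupp.add_apply, ← h2, mult_cons]
        by_cases hi : i = 0
        · simp [hi, h4]
        · simp [hi]

/-- Removing a zero of the first block keeps inv: `0` is never the larger letter of a pair, and the
first block is never on the right. -/
theorem inv_zeroFirst_single_add (e : ℕ →₀ ℕ) (B : ℕ) :
    genFun invPair ZeroFirst (Finsupp.single 0 1 + e) (B + 1) =
      invGF e B + (invGF e (B + 1) - genFun invPair ZeroFirst e (B + 1)) := by
  classical
  have hL : invGF e (B + 1) - genFun invPair ZeroFirst e (B + 1) =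
      ∑ π ∈ (content e (B + 1)).filter fun π => ¬ ZeroFirst π, q ^ pairSum invPair π := by
    rw [invGF, genFun, genFun, Finset.sum_filter, ← Finset.sum_sub_distrib]
    refine Finset.sum_congr rfl fun π _ => ?_
    by_cases h : ZeroFirst π <;> simp [h]
  have hF : invGF e B = ∑ π ∈ content e B, q ^ pairSum invPair π := by
    rw [invGF, genFun]
    simp only [if_true]
  rw [hL, hF, genFun, ← Finset.sum_filter, content_filter_zeroFirst, Finset.sum_union,
    Finset.sum_image fun x _ y _ h => (List.cons.inj h).2, Finset.sum_image]
  · congr 1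
    · exact Finset.sum_congr rfl fun π _ => by rw [pairSum_cons_zero]
    · exact Finset.sum_congr rfl fun π _ => by rw [pairSum_zeroHead]
  · intro x hx y hy h
    obtain ⟨hx, hx0⟩ := Finset.mem_filter.1 hx
    obtain ⟨hy, hy0⟩ := Finset.mem_filter.1 hy
    rcases x with _ | ⟨H, x⟩ <;> rcases y with _ | ⟨K, y⟩
    · rfl
    · simp [zeroHead] at h
    · simp [zeroHead] at h
    · rw [zeroFirst_cons] at hx0 hy0
      rw [zeroHead, zeroHead, List.cons.injEq] at h
      rw [h.2, ← Finset.erase_insert hx0, h.1, Finset.erase_insert hy0]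
  · rw [Finset.disjoint_left]
    intro π h1 h2
    obtain ⟨x, hx, rfl⟩ := Finset.mem_image.1 h1
    obtain ⟨y, hy, h⟩ := Finset.mem_image.1 h2
    obtain ⟨hy, hy0⟩ := Finset.mem_filter.1 hy
    rcases y with _ | ⟨K, y⟩
    · simp [zeroHead] at h
    · rw [zeroFirst_cons] at hy0
      rw [zeroHead, List.cons.injEq] at h
      obtain ⟨i, hi⟩ := (mem_content.1 hy).1 K List.mem_cons_self
      have : i ∈ ({0} : Finset ℕ) := by
        rw [← h.1]
        exact Finset.mem_insert_of_mem hi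
      rw [Finset.mem_singleton.1 this] at hi
      exact hy0 hi

/-! ### Coefficients of the two families of series -/

/-- The coefficients of `invOPL`. -/
def coeffL (m k : ℕ) (d : ℕ →₀ ℕ) : Kqt :=
  invGF (consExp m d) (m + k) - genFun invPair ZeroFirst (consExp m d) (m + k)

/-- The coefficients of `dinvOPR`. -/
def coeffR (m k : ℕ) (d : ℕ →₀ ℕ) : Kqt :=
  invGF (consExp m d) (m + k) - genFun dinvPair ZeroLast (consExp m d) (m + k)

theorem sum_card_erase_zero (d : ℕ →₀ ℕ) (π : List (Finset ℕ))
    (h : ∀ i, mult (i + 1) π = d i) : (π.map fun B => (B.erase 0).card).sum = d.degree := by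
  have h1 : ∀ B ∈ π, (B.erase 0).card = ∑ i ∈ d.support, if i + 1 ∈ B then 1 else 0 := by
    intro B hB
    rw [← Finset.card_filter]
    symm
    refine Finset.card_bij (fun i _ => i + 1) ?_ ?_ ?_
    · intro i hi
      simpa using (Finset.mem_filter.1 hi).2
    · intro i _ j _ hij
      exact Nat.succ.inj hij
    · intro i hi
      rw [Finset.mem_erase] at hi
      obtain ⟨i, rfl⟩ := Nat.exists_eq_succ_of_ne_zero hi.1
      refine ⟨i, Finset.mem_filter.2 ⟨?_, hi.2⟩, rfl⟩
      rw [Finsupp.mem_support_iff, ← h i]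
      exact mult_pos hB hi.2
  have h2 : ∀ σ : List (Finset ℕ),
      (σ.map fun B => ∑ i ∈ d.support, if i + 1 ∈ B then 1 else 0).sum =
        ∑ i ∈ d.support, mult (i + 1) σ := by
    intro σ
    induction σ with
    | nil => simp [mult_nil]
    | cons B σ ih =>
      rw [List.map_cons, List.sum_cons, ih, ← Finset.sum_add_distrib]
      simp only [mult_cons]
  rw [List.map_congr_left h1, h2, Finsupp.degree_apply]
  exact Finset.sum_congr rfl fun i _ => h i

/-- The content fixes the number of positive letters, so `n` only constrains the degree of `d`. -/
theorem mem_ofContent_OP {m n k : ℕ} {d : ℕ →₀ ℕ} {π : List (Finset ℕ)} :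
    (π ∈ OP m n k ∧ ∀ i, mult (i + 1) π = d i) ↔
      d.degree = n ∧ π ∈ content (consExp m d) (m + k) := by
  rw [mem_content]
  constructor
  · rintro ⟨⟨h1, h2, h3, h4⟩, h5⟩
    refine ⟨by rw [← h3, sum_card_erase_zero d π h5], h1, fun i => ?_, h4⟩
    rcases i with _ | i
    · rw [h2, consExp_zero]
    · rw [h5, consExp_succ]
  · rintro ⟨rfl, h1, h2, h3⟩
    have h5 : ∀ i, mult (i + 1) π = d i := fun i => by rw [h2, consExp_succ]
    exact ⟨⟨h1, by rw [h2, consExp_zero], sum_card_erase_zero d π h5, h3⟩, h5⟩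

theorem coeff_dinvOPR (m n k : ℕ) (d : ℕ →₀ ℕ) :
    dinvOPR m n k d = if d.degree = n then coeffR m k d else 0 := by
  classical
  rw [dinvOPR]
  have hmem : ∀ π, π ∈ (finite_OPR m n k d).toFinset ↔
      d.degree = n ∧ π ∈ (content (consExp m d) (m + k)).filter fun π => ¬ ZeroLast π := by
    intro π
    rw [Set.Finite.mem_toFinset, Finset.mem_filter, ← and_assoc, ← mem_ofContent_OP]
    simp only [ofContent, OPR, Set.mem_ofPred_eq, ZeroLast, not_exists, not_and]
    tauto
  split_ifs with hd
  · have : (finite_OPR m n k d).toFinset =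
        (content (consExp m d) (m + k)).filter fun π => ¬ ZeroLast π := by
      ext π
      rw [hmem, and_iff_right hd]
    rw [this, coeffR, ← genFun_dinv_eq, genFun, genFun, Finset.sum_filter,
      ← Finset.sum_sub_distrib]
    refine Finset.sum_congr rfl fun π _ => ?_
    by_cases h : ZeroLast π <;> simp [h, dinv]
  · refine Finset.sum_eq_zero fun π hπ => absurd ((hmem π).1 hπ).1 hd

theorem coeff_invOPL (m n k : ℕ) (d : ℕ →₀ ℕ) :
    invOPL m n k d = if d.degree = n then coeffL m k d else 0 := by
  classical
  rw [invOPL]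
  have hmem : ∀ π, π ∈ (finite_OPL m n k d).toFinset ↔
      d.degree = n ∧ π ∈ (content (consExp m d) (m + k)).filter fun π => ¬ ZeroFirst π := by
    intro π
    rw [Set.Finite.mem_toFinset, Finset.mem_filter, ← and_assoc, ← mem_ofContent_OP]
    simp only [ofContent, OPL, Set.mem_ofPred_eq, ZeroFirst, not_exists, not_and]
    tauto
  split_ifs with hd
  · have : (finite_OPL m n k d).toFinset =
        (content (consExp m d) (m + k)).filter fun π => ¬ ZeroFirst π := by
      ext π
      rw [hmem, and_iff_right hd]
    rw [this, coeffL, invGF, genFun, genFun, Finset.sum_filter, ← Finset.sum_sub_distrib]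
    refine Finset.sum_congr rfl fun π _ => ?_
    by_cases h : ZeroFirst π <;> simp [h, inv]
  · refine Finset.sum_eq_zero fun π hπ => absurd ((hmem π).1 hπ).1 hd

/-- The sequences with a zero in the last block account for `q^k [m]`, and `[m+k] - q^k [m] = [k]`.
-/
theorem qNum_mul_coeffR (m k : ℕ) (d : ℕ →₀ ℕ) :
    qNum (m + k) * coeffR m k d = qNum k * invGF (consExp m d) (m + k) := by
  have h := qNum_mul_dinv_zeroLast (consExp m d) (m + k)
  rw [consExp_zero, pow_add, mul_assoc] at h
  have h1 := mul_left_cancel₀ (pow_ne_zero m q_ne_zero) h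
  rw [coeffR, mul_sub, h1]
  have h2 := qNum_add k m
  rw [add_comm k m] at h2
  rw [h2]
  ring

theorem genFun_zeroFirst_consExp (m k : ℕ) (d : ℕ →₀ ℕ) :
    qNum (m + k) * genFun invPair ZeroFirst (consExp m d) (m + k) =
      qNum m * invGF (consExp m d) (m + k) := by
  rw [qNum_mul_inv_zeroFirst, consExp_zero]

theorem coeffR_congr {d d' : ℕ →₀ ℕ} (h : exps d = exps d') (m k : ℕ) :
    coeffR m k d = coeffR m k d' := by
  -- `[0]_q = 0` cannot be cancelled, so the case of no blocks is treated directly.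
  rcases Nat.eq_zero_or_pos (m + k) with h0 | h0
  · have : ∀ e, genFun dinvPair ZeroLast e (m + k) = 0 := by
      intro e
      refine Finset.sum_eq_zero fun π hπ => if_neg ?_
      rw [List.length_eq_zero_iff.1 ((mem_content.1 hπ).2.2.trans h0)]
      exact not_zeroLast_nil
    rw [coeffR, coeffR, this, this, invGF_consExp_congr h]
  · refine mul_left_cancel₀ (qNum_ne_zero h0.ne') ?_
    rw [qNum_mul_coeffR, qNum_mul_coeffR, invGF_consExp_congr h]

theorem coeffL_congr {d d' : ℕ →₀ ℕ} (h : exps d = exps d') (m k : ℕ) :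
    coeffL m k d = coeffL m k d' := by
  rw [coeffL, coeffL, invGF_consExp_congr h]
  congr 1
  rcases Nat.eq_zero_or_pos (m + k) with h0 | h0
  · have : ∀ e, genFun invPair ZeroFirst e (m + k) = 0 := by
      intro e
      refine Finset.sum_eq_zero fun π hπ => if_neg ?_
      rw [List.length_eq_zero_iff.1 ((mem_content.1 hπ).2.2.trans h0)]
      exact not_zeroFirst_nil
    rw [this, this]
  · refine mul_left_cancel₀ (qNum_ne_zero h0.ne') ?_
    rw [genFun_zeroFirst_consExp, genFun_zeroFirst_consExp, invGF_consExp_congr h]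

theorem mem_Sym_of_exps {f : Series} {n : ℕ} {c : (ℕ →₀ ℕ) → Kqt}
    (hf : ∀ d, f d = if d.degree = n then c d else 0)
    (hc : ∀ d d', exps d = exps d' → c d = c d') : f ∈ Sym := by
  refine mem_Sym_of_coeff n (fun σ d => ?_) (fun d hd => ?_)
  · change f _ = f _
    rw [hf, hf, hc _ _ (exps_embDomain σ d), ← sum_exps, exps_embDomain, sum_exps]
  · by_contra h
    refine hd ?_
    change f d = 0
    rw [hf, if_neg h]

theorem dinvOPR_mem_Sym (m n k : ℕ) : dinvOPR m n k ∈ Sym :=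
  mem_Sym_of_exps (coeff_dinvOPR m n k) fun _ _ h => coeffR_congr h m k

theorem invOPL_mem_Sym (m n k : ℕ) : invOPL m n k ∈ Sym :=
  mem_Sym_of_exps (coeff_invOPL m n k) fun _ _ h => coeffL_congr h m k

theorem genFun_zeroFirst_consExp_zero (d : ℕ →₀ ℕ) (B : ℕ) :
    genFun invPair ZeroFirst (consExp 0 d) B = 0 := by
  refine Finset.sum_eq_zero fun π hπ => if_neg ?_
  rintro ⟨C, hC, h0⟩
  have h1 := (mem_content.1 hπ).2.1 0
  rw [consExp_zero] at h1
  exact mult_pos (List.mem_of_mem_head? hC) h0 h1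

/-- Telescoping: stripping the zero of the first block leaves `M - 1` zeros and one of two block
numbers. The sequences left that still start with a zero are those of the same sum for `M - 1`. -/
theorem sum_coeffL (M K : ℕ) (d : ℕ →₀ ℕ) :
    ∑ r ∈ Finset.Icc 1 M, (coeffL (M - r) K d + coeffL (M - r) (K + 1) d) =
      genFun invPair ZeroFirst (consExp M d) (M + K) := by
  have h1 : ∑ r ∈ Finset.Icc 1 M, (coeffL (M - r) K d + coeffL (M - r) (K + 1) d) =
      ∑ i ∈ Finset.range M, (coeffL i K d + coeffL i (K + 1) d) := by
    refine Finset.sum_nbij' (fun r => M - r) (fun i => M - i) ?_ ?_ ?_ ?_ ?_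
    · intro r hr
      rw [Finset.mem_Icc] at hr
      rw [Finset.mem_range]
      omega
    · intro i hi
      rw [Finset.mem_range] at hi
      rw [Finset.mem_Icc]
      omega
    · intro r hr
      rw [Finset.mem_Icc] at hr
      omega
    · intro i hi
      rw [Finset.mem_range] at hi
      omega
    · intro r _
      rfl
  rw [h1]
  clear h1
  induction M with
  | zero => rw [genFun_zeroFirst_consExp_zero, Finset.sum_range_zero]
  | succ M ih =>
    have h2 : consExp (M + 1) d = Finsupp.single 0 1 + consExp M d := by
      rw [consExp, consExp, ← add_assoc, ← Finsupp.single_add, add_comm M 1]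
    rw [Finset.sum_range_succ, ih, h2, show M + 1 + K = M + K + 1 by ring,
      inv_zeroFirst_single_add, coeffL, coeffL, ← add_assoc M K 1]
    ring

/-! ### The recursion -/

/-- For `s > j` the exponent is truncated, but the lower argument is negative and the coefficient
vanishes. -/
theorem qBinom_eq_qElem (m j s : ℕ) :
    q ^ ((j - s).choose 2) * qBinom m ((j : ℤ) - s) = if s ≤ j then qElem m (j - s) else 0 := by
  split_ifs with h
  · rw [qElem, gaussBinom, Nat.cast_sub h]
  · rw [qBinom, if_neg (by omega), mul_zero]

/-- Absorption; at `s = 0` both sides vanish, by the convention for negative lower arguments and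
`[0]_q = 0`. -/
theorem qBinom_pred_mul (m s : ℕ) :
    qBinom ((m : ℤ) + s - 1) ((s : ℤ) - 1) * qNum (m + s) = gaussBinom (m + s) s * qNum s := by
  rcases s with _ | s
  · rw [qBinom, if_neg (by omega), qNum_zero, zero_mul, mul_zero]
  · have h1 : qBinom ((m : ℤ) + (s + 1 : ℕ) - 1) (((s + 1 : ℕ) : ℤ) - 1) = gaussBinom (m + s) s := by
      rw [gaussBinom]
      congr 1 <;> push_cast <;> ring
    rw [h1, gaussBinom_add, gaussBinom_add, ← add_assoc, qFact_succ, qFact_succ]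
    have := qFact_ne_zero m
    have := qFact_ne_zero s
    have := qNum_ne_zero s.succ_ne_zero
    field_simp

theorem invGF_consExp_of_lt {m B : ℕ} (h : B < m) (d : ℕ →₀ ℕ) : invGF (consExp m d) B = 0 := by
  refine Finset.sum_eq_zero fun π hπ => ?_
  have h1 := (mem_content.1 hπ).2.1 0
  rw [consExp_zero] at h1
  have h2 : mult 0 π ≤ π.length := List.countP_le_length
  have h3 := (mem_content.1 hπ).2.2
  omega

theorem coeffR_consExp (m j k : ℕ) (hk : 1 ≤ k) (d : ℕ →₀ ℕ) :
    coeffR m k (consExp j d) = ∑ s ∈ Finset.range (k + 1),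
      (q ^ ((j - s).choose 2) * qBinom m ((j : ℤ) - s) * qBinom ((m : ℤ) + s) s * q ^ s *
          coeffR (m + s) (k - s) d +
        q ^ ((j - s).choose 2) * qBinom m ((j : ℤ) - s) *
          qBinom ((m : ℤ) + s - 1) ((s : ℤ) - 1) *
          genFun invPair ZeroFirst (consExp (m + s) d) (m + s + (k - s))) := by
  refine mul_left_cancel₀ (qNum_ne_zero (show m + k ≠ 0 by omega)) ?_
  have hext : invGF (consExp m (consExp j d)) (m + k) = ∑ s ∈ Finset.range (k + 1),
      (if s ≤ j then qElem m (j - s) else 0) * gaussBinom (m + s) s *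
        invGF (consExp (m + s) d) (m + k) := by
    have h1 : invGF (consExp m (consExp j d)) (m + k) = ∑ s ∈ Finset.range (j + 1),
        (if s ≤ j then qElem m (j - s) else 0) * gaussBinom (m + s) s *
          invGF (consExp (m + s) d) (m + k) := by
      rw [invGF_consExp_consExp]
      refine Finset.sum_congr rfl fun s hs => ?_
      rw [if_pos (Nat.lt_succ_iff.1 (Finset.mem_range.1 hs))]
    -- The sum may stop at `j` or at `k`: terms with `s > j` are zero by definition, and terms with
    -- `s > k` have more zeros than blocks.
    have h2 : ∀ n, n = j ∨ n = k → ∑ s ∈ Finset.range (n + 1),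
        (if s ≤ j then qElem m (j - s) else 0) * gaussBinom (m + s) s *
          invGF (consExp (m + s) d) (m + k) = ∑ s ∈ Finset.range (j + k + 1),
        (if s ≤ j then qElem m (j - s) else 0) * gaussBinom (m + s) s *
          invGF (consExp (m + s) d) (m + k) := by
      intro n hn
      refine Finset.sum_subset (Finset.range_mono (by omega)) fun s _ hs => ?_
      have hs : n < s := by simpa using hs
      rcases hn with rfl | rfl
      · rw [if_neg (by omega), zero_mul, zero_mul]
      · rw [invGF_consExp_of_lt (by omega), mul_zero]
    rw [h1, h2 j (Or.inl rfl), ← h2 k (Or.inr rfl)]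
  rw [qNum_mul_coeffR, hext, Finset.mul_sum, Finset.mul_sum]
  refine Finset.sum_congr rfl fun s hs => ?_
  have hsk : s ≤ k := Nat.lt_succ_iff.1 (Finset.mem_range.1 hs)
  obtain ⟨t, rfl⟩ := Nat.exists_eq_add_of_le hsk
  rw [qBinom_eq_qElem, Nat.add_sub_cancel_left]
  have hR := qNum_mul_coeffR (m + s) t d
  have hZ := genFun_zeroFirst_consExp (m + s) t d
  have hB := qBinom_pred_mul m s
  have hG : qBinom ((m : ℤ) + s) s = gaussBinom (m + s) s := by
    rw [gaussBinom, Nat.cast_add]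
  rw [hG, ← add_assoc, qNum_add s t]
  -- With `k = s + t`, the part `q^s [t]` of `[k]` belongs to `hR`, and the part `[s]` to `hB` and
  -- `hZ`.
  linear_combination (-(if s ≤ j then qElem m (j - s) else 0)) *
    (gaussBinom (m + s) s * q ^ s * hR + qBinom ((m : ℤ) + s - 1) ((s : ℤ) - 1) * hZ +
      invGF (consExp (m + s) d) (m + s + t) * hB)

theorem dinvOPR_zero (m k : ℕ) : dinvOPR m 0 k = if k = 0 ∧ m = 0 then 1 else 0 := by
  classical
  have hone : ∀ d : ℕ →₀ ℕ, (1 : Series) d = if d = 0 then 1 else 0 := fun d =>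
    MvPowerSeries.coeff_one d
  refine MvPowerSeries.ext fun d => ?_
  change dinvOPR m 0 k d = (if k = 0 ∧ m = 0 then (1 : Series) else 0) d
  rw [coeff_dinvOPR]
  by_cases hd : d = 0
  · subst hd
    rw [if_pos (by simp)]
    by_cases h0 : m + k = 0
    · obtain ⟨rfl, rfl⟩ : m = 0 ∧ k = 0 := by omega
      have h1 : consExp 0 0 = Finsupp.single 0 0 := by simp [consExp]
      rw [if_pos ⟨rfl, rfl⟩, hone, if_pos rfl, coeffR, h1, invGF_single_zero,
        genFun_single_zero dinvPair_zero]
      simp [not_zeroLast_nil]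
    · rw [if_neg (by omega)]
      change coeffR m k 0 = 0
      refine (mul_eq_zero.1 ?_).resolve_left (qNum_ne_zero h0)
      have h1 : consExp m 0 = Finsupp.single 0 m := by simp [consExp]
      rw [qNum_mul_coeffR, h1, invGF_single_zero]
      rcases k with _ | k
      · rw [qNum_zero, zero_mul]
      · rw [if_neg (by omega), mul_zero]
  · rw [if_neg (by rwa [Finsupp.degree_eq_zero_iff])]
    split_ifs
    · rw [hone, if_neg hd]
    · rfl

end OrdSetPart

end

/-! ### Comparison of coefficients in the main theorem. -/

theorem mainTheorem9 :
    ∃ (hR : ∀ m n k : ℕ, OrdSetPart.dinvOPR m n k ∈ OrdSetPart.Sym)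
      (hL : ∀ m n k : ℕ, OrdSetPart.invOPL m n k ∈ OrdSetPart.Sym),
      (∀ m n k j : ℕ, 1 ≤ j → j < n → 1 ≤ k → k ≤ n →
        OrdSetPart.hPerp j ⟨OrdSetPart.dinvOPR m n k, hR m n k⟩ =
          (∑ s ∈ Finset.range (k + 1),
            (OrdSetPart.q ^ ((j - s).choose 2) * OrdSetPart.qBinom m ((j : ℤ) - s) *
              OrdSetPart.qBinom ((m : ℤ) + s) s * OrdSetPart.q ^ s) •
              (⟨OrdSetPart.dinvOPR (m + s) (n - j) (k - s), hR _ _ _⟩ : OrdSetPart.Sym)) +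
          ∑ s ∈ Finset.range (k + 1),
            (OrdSetPart.q ^ ((j - s).choose 2) * OrdSetPart.qBinom m ((j : ℤ) - s) *
              OrdSetPart.qBinom ((m : ℤ) + s - 1) ((s : ℤ) - 1)) •
              ∑ r ∈ Finset.Icc 1 (m + s),
                ((⟨OrdSetPart.invOPL (m + s - r) (n - j) (k - s), hL _ _ _⟩ : OrdSetPart.Sym) +
                  ⟨OrdSetPart.invOPL (m + s - r) (n - j) (k - s + 1), hL _ _ _⟩)) ∧
      ∀ m k : ℕ, OrdSetPart.dinvOPR m 0 k = if k = 0 ∧ m = 0 then 1 else 0 := by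
  refine ⟨OrdSetPart.dinvOPR_mem_Sym, OrdSetPart.invOPL_mem_Sym, ?_, OrdSetPart.dinvOPR_zero⟩
  intro m n k j hj hjn hk _
  refine OrdSetPart.Sym_ext fun d => ?_
  have hR : ∀ (m n k : ℕ) (h : OrdSetPart.dinvOPR m n k ∈ OrdSetPart.Sym) (d : ℕ →₀ ℕ),
      OrdSetPart.coeffSym d ⟨OrdSetPart.dinvOPR m n k, h⟩ =
        if d.degree = n then OrdSetPart.coeffR m k d else 0 :=
    fun m n k _ d => OrdSetPart.coeff_dinvOPR m n k d
  have hL : ∀ (m n k : ℕ) (h : OrdSetPart.invOPL m n k ∈ OrdSetPart.Sym) (d : ℕ →₀ ℕ),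
      OrdSetPart.coeffSym d ⟨OrdSetPart.invOPL m n k, h⟩ =
        if d.degree = n then OrdSetPart.coeffL m k d else 0 :=
    fun m n k _ d => OrdSetPart.coeff_invOPL m n k d
  rw [OrdSetPart.coeff_hPerp (by omega), hR, OrdSetPart.degree_consExp, map_add, map_sum, map_sum]
  simp only [map_smul, map_sum, map_add, hR, hL, smul_eq_mul]
  -- All series are homogeneous. As `j < n`, `j + d.degree = n` means `d.degree = n - j`; in any
  -- other degree both sides vanish.
  by_cases hd : d.degree = n - j
  · rw [if_pos (by omega)]
    simp only [if_pos hd, OrdSetPart.sum_coeffL]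
    rw [OrdSetPart.coeffR_consExp m j k hk, Finset.sum_add_distrib]
  · rw [if_neg (by omega)]
    simp only [if_neg hd, add_zero, Finset.sum_const_zero, mul_zero]
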